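/- **Setting.** Let $K$ be a number field with a fixed embedding $K\hookrightarrow\mathbb C$, let $d\ge 1$, and let $v$ be a finite place of $K$ above the prime $p=p(v)$. Normalize $|\cdot|_v$ by $|p|_v=p^{-1}$, put $\pi_v=|p|_v^{1/(p-1)}$, and let $K\cap\mathbb Z_p$ be the set of elements of $K$ lying in $\mathbb Z_p$ (the closure of $\mathbb Z$ in $K_v$). For $f=\sum_{\alpha\in\mathbb N^d}a_\alpha x^\alpha\in K[[x]]=K[[x_1,\dots,x_d]]$ write $f(1/x)=\sum_\alpha a_\alpha x^{-\alpha}$, let $r_v(f)=\bigl(\limsup_{|\alpha|\to\infty}|a_\alpha|_v^{1/|\alpha|}\bigr)^{-1}\in[0,\infty]$ be its $v$-adic radius of convergence, and for $s\in\mathbb Q$ put $\mathcal R_v^s(f)=\{y\in K[[x]] : r_v(y)\ge r_v(f)\,\pi_v^s\}$. View $\mathbb C\otimes_K\mathcal R_v^s(f)$ inside $\mathbb C[[x]]$. Write $h_{\gamma,k}=x^\gamma(\log x)^k=\prod_i x_i^{\gamma_i}(\log x_i)^{k_i}$ and $\Gamma(\gamma)=\prod_i\Gamma(\gamma_i)$.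 The standard Laplace transform $\mathcal L$ is defined as follows. In one variable, for $\gamma\in K\setminus\mathbb Z$ and $k\in\mathbb N$, $$\mathcal L(h_{\gamma,k})=\sum_{j=0}^k\binom kj\Gamma^{(j)}(\gamma+1)\,x^{-\gamma-1}(-1)^{k-j}(\log x)^{k-j}\quad\text{if }\operatorname{Re}\gamma>-1,$$ and otherwise $\mathcal L(h_{\gamma,k})=x^{n+1}\mathcal L(F_{\gamma,k,n})$ for any integer $n>0$ with $n\ge-\operatorname{Re}\gamma-1$, where $$F_{\gamma,k,n}=\sum_{m=0}^n\frac{(-1)^m}{m!(n-m)!}\,\frac{x^{\gamma+n+1}}{m+\gamma+1}\sum_{\ell=0}^k\frac{k!\,(-1)^{k-\ell}}{\ell!\,(m+\gamma+1)^{k-\ell}}(\log x)^\ell .$$ In $d$ variables, for $\gamma\in(K\setminus\mathbb Z)^d$ and $k\in\mathbb N^d$, $\mathcal L(h_{\gamma,k})=\prod_i\mathcal L_i(h_{\gamma_i,k_i})$, with $\mathcal L_i$ the one-variable transform in $x_i$, and $$\mathcal L(f h_{\gamma,k})=\sum_\alpha a_\alpha\,\mathcal L(h_{\gamma+\alpha,k}),\qquad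 \mathcal L(f(1/x)h_{\gamma,k})=\sum_\alpha a_\alpha\,\mathcal L(h_{\gamma-\alpha,k}).$$ **Proposition 3.8.** Let $f\in K[[x]]$, $k\in\mathbb N^d$ and $\gamma\in(K\cap\mathbb Z_p\setminus\mathbb Z)^d$. There exist power series $f_{\gamma,k,j}\in\mathbb C\otimes_K\mathcal R_v^{-1}(f)$ and $f^*_{\gamma,k,j}\in\mathbb C\otimes_K\mathcal R_v^{1}(f)$, for $j\in\mathbb N^d$ with $j\le k$ componentwise, such that $$\mathcal L(f h_{\gamma,k})=x^{-\gamma-1}\,\Gamma(\gamma)\sum_{j\le k}f_{\gamma,k,j}(1/x)\,(\log x)^j,$$ $$\mathcal L(f(1/x)h_{\gamma,k})=x^{-\gamma-1}\,\Gamma(\gamma)\sum_{j\le k}f^*_{\gamma,k,j}(x)\,(\log x)^j .$$ Moreover $f_{\gamma,k,k}$ and $f^*_{\gamma,k,k}$ have coefficients in $K$, with $$r_v(f_{\gamma,k,k})=r_v(f)\,\pi_v^{-1},\qquad r_v(f^*_{\gamma,k,k})=r_v(f)\,\pi_v,$$ and both are nonzero if $f\ne0$. Finally, let $\phi\in K[x_1,\dots,x_d,\partial_1,\dots,\partial_d]$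 (the Weyl algebra), and let $\mathcal F$ be the Fourier–Laplace transform, the $K$-automorphism of this algebra with $\mathcal F(x_i)=-\partial_i$ and $\mathcal F(\partial_i)=x_i$. If $\phi(fh_{\gamma,k})=0$, then $\mathcal F(\phi)\bigl(\mathcal L(fh_{\gamma,k})\bigr)=0$; if $\phi(f(1/x)h_{\gamma,k})=0$, then $\mathcal F(\phi)\bigl(\mathcal L(f(1/x)h_{\gamma,k})\bigr)=0$. All identities are between formal series. -/

import Mathlib

open Filter
open scoped NumberField ENNReal

noncomputable section

namespace LaplaceSeveral

/-! ### Finite places: the normalized absolute value, `π_v`, radius of convergence -/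

section Places

variable {K : Type*} [Field K] [NumberField K]

/-- The rational prime `p(v)` below the finite place `v`. -/
def residuePrime (v : NumberField.FinitePlace K) : ℕ :=
  ringChar (𝓞 K ⧸ v.maximalIdeal.asIdeal)

/-- The `v`-adic absolute value normalized by `|p(v)|_v = p(v)⁻¹`: the power of Mathlib's
`v`-adic absolute value with this property (see `absV_residuePrime`). -/
def absV (v : NumberField.FinitePlace K) (x : K) : ℝ :=
  v x ^ Real.logb (v (residuePrime v : K)) ((residuePrime v : ℝ)⁻¹)

theorem residuePrime_prime (v : NumberField.FinitePlace K) : (residuePrime v).Prime := by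
  have : Finite (𝓞 K ⧸ v.maximalIdeal.asIdeal) :=
    Ideal.finiteQuotientOfFreeOfNeBot _ v.maximalIdeal.ne_bot
  have : v.maximalIdeal.asIdeal.IsPrime := v.maximalIdeal.isPrime
  exact (CharP.char_is_prime_or_zero (𝓞 K ⧸ v.maximalIdeal.asIdeal) (residuePrime v)).resolve_right
    (CharP.char_ne_zero_of_finite (𝓞 K ⧸ v.maximalIdeal.asIdeal) (residuePrime v))

theorem apply_residuePrime_lt_one (v : NumberField.FinitePlace K) :
    v (residuePrime v : K) < 1 := by
  have h : ((residuePrime v : ℕ) : 𝓞 K) ∈ v.maximalIdeal.asIdeal := by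
    rw [← Ideal.Quotient.eq_zero_iff_mem, map_natCast]
    exact ringChar.Nat.cast_ringChar
  have h2 := (NumberField.FinitePlace.norm_lt_one_iff_mem (K := K) v.maximalIdeal _).2 h
  rw [NumberField.FinitePlace.norm_embedding_eq] at h2
  simpa using h2

/-- The normalization `|p(v)|_v = p(v)⁻¹`. -/
theorem absV_residuePrime (v : NumberField.FinitePlace K) :
    absV v (residuePrime v : K) = (residuePrime v : ℝ)⁻¹ := by
  have hp := (residuePrime_prime v).pos
  have h0 : 0 < v (residuePrime v : K) := by
    rw [NumberField.FinitePlace.pos_iff]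
    exact_mod_cast hp.ne'
  exact Real.rpow_logb h0 (apply_residuePrime_lt_one v).ne (by positivity)

/-- `π_v = |p(v)|_v ^ (1 / (p(v) - 1))`. -/
def piV (v : NumberField.FinitePlace K) : ℝ :=
  absV v (residuePrime v : K) ^ (1 / ((residuePrime v : ℝ) - 1))

/-- `K ∩ ℤ_{p(v)}`: the elements of `K` that lie in `ℤ_{p(v)}`, the closure of `ℤ` in the
completion of `K` at `v`. -/
def padicIntegers (v : NumberField.FinitePlace K) : Set K :=
  {x | ∀ ε : ℝ, 0 < ε → ∃ n : ℤ, absV v (x - n) < ε}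

variable {d : ℕ}

/-- The `v`-adic radius of convergence of `f = ∑ a_α x^α`, by the Cauchy-Hadamard formula
`r_v(f) = (limsup_{|α| → ∞} |a_α|_v ^ (1 / |α|))⁻¹ ∈ [0, ∞]`. For `0 < d` the
filter `cofinite` on multi-indices is `|α| → ∞`. -/
def radius (v : NumberField.FinitePlace K) (f : MvPowerSeries (Fin d) K) : ℝ≥0∞ :=
  (limsup (fun α : Fin d →₀ ℕ =>
    ENNReal.ofReal (absV v (MvPowerSeries.coeff α f) ^ (1 / (α.degree : ℝ)))) cofinite)⁻¹

/-- The set `𝓡_v^s(f)` of all power series `y` over `K` with `r_v(y) ≥ r_v(f) π_v^s`. -/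
def RSet (v : NumberField.FinitePlace K) (s : ℚ) (f : MvPowerSeries (Fin d) K) :
    Set (MvPowerSeries (Fin d) K) :=
  {y | radius v f * ENNReal.ofReal (piV v ^ (s : ℝ)) ≤ radius v y}

/-- `ℂ ⊗_K 𝓡_v^s(f)`, seen in `ℂ[[x]]` (as `ℂ ⊗_K K[[x]]` embeds in `ℂ[[x]]`): the `ℂ`-linear
combinations of elements of `𝓡_v^s(f)`. -/
def complexRSet [Algebra K ℂ] (v : NumberField.FinitePlace K) (s : ℚ)
    (f : MvPowerSeries (Fin d) K) : Submodule ℂ (MvPowerSeries (Fin d) ℂ) :=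
  Submodule.span ℂ (MvPowerSeries.map (algebraMap K ℂ) '' RSet v s f)

end Places

/-! ### Formal series with exponents and logarithms -/

/-- Formal sums `∑_δ x^δ P_δ(log x_1, …, log x_d)` with exponents `δ ∈ E^d`, where each `P_δ` is a
polynomial over `E`; such a sum is the family `δ ↦ P_δ`. -/
abbrev LogSeries (E : Type*) [CommRing E] (d : ℕ) : Type _ :=
  (Fin d → E) → MvPolynomial (Fin d) E

section LogSeries

variable {E : Type*} [CommRing E] {d : ℕ}

/-- `f · x^γ (log x)^k` for `f = ∑ a_α x^α`, that is `∑ a_α x^(γ + α) (log x)^k`. -/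
def mulH (f : MvPowerSeries (Fin d) E) (γ : Fin d → E) (k : Fin d →₀ ℕ) : LogSeries E d :=
  Function.extend (fun (α : Fin d →₀ ℕ) (i : Fin d) => γ i + (α i : E))
    (fun α => MvPolynomial.monomial k (MvPowerSeries.coeff α f)) 0

/-- `f(1/x) · x^γ (log x)^k` for `f = ∑ a_α x^α`, that is `∑ a_α x^(γ - α) (log x)^k`. -/
def mulHInv (f : MvPowerSeries (Fin d) E) (γ : Fin d → E) (k : Fin d →₀ ℕ) : LogSeries E d :=
  Function.extend (fun (α : Fin d →₀ ℕ) (i : Fin d) => γ i - (α i : E))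
    (fun α => MvPolynomial.monomial k (MvPowerSeries.coeff α f)) 0

variable (K : Type*) [CommRing K] [Algebra K E]

/-- Multiplication by `x_i`. -/
def mulX (i : Fin d) : LogSeries E d →ₗ[K] LogSeries E d :=
  LinearMap.funLeft K (MvPolynomial (Fin d) E) fun δ : Fin d → E => δ - Pi.single i 1

/-- The derivation `∂_i`: `∂_i (x^δ P(log x)) = x^(δ - e_i) (δ_i P + ∂P/∂(log x_i))(log x)`. -/
def partialD (i : Fin d) : LogSeries E d →ₗ[K] LogSeries E d where
  toFun g δ := (δ i + 1) • g (δ + Pi.single i 1) + MvPolynomial.pderiv i (g (δ + Pi.single i 1))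
  map_add' g h := by
    funext δ
    simp only [Pi.add_apply, smul_add, map_add]
    abel
  map_smul' c g := by
    funext δ
    simp only [Pi.smul_apply, RingHom.id_apply, smul_add]
    rw [smul_comm (δ i + 1) c, ← algebraMap_smul E c (g (δ + Pi.single i 1)),
      Derivation.map_smul, algebraMap_smul]

end LogSeries

/-! ### The Weyl algebra and the Fourier-Laplace transform -/

section Weyl

variable (K : Type*) [CommRing K] (d : ℕ)

/-- The relations of the Weyl algebra; `Sum.inl i` stands for `x_i`, `Sum.inr i` for `∂_i`. -/
inductive WeylRel : FreeAlgebra K (Fin d ⊕ Fin d) → FreeAlgebra K (Fin d ⊕ Fin d) → Prop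
  | x_comm (i j : Fin d) : WeylRel
      (FreeAlgebra.ι K (Sum.inl i) * FreeAlgebra.ι K (Sum.inl j))
      (FreeAlgebra.ι K (Sum.inl j) * FreeAlgebra.ι K (Sum.inl i))
  | d_comm (i j : Fin d) : WeylRel
      (FreeAlgebra.ι K (Sum.inr i) * FreeAlgebra.ι K (Sum.inr j))
      (FreeAlgebra.ι K (Sum.inr j) * FreeAlgebra.ι K (Sum.inr i))
  | d_x (i j : Fin d) : WeylRel
      (FreeAlgebra.ι K (Sum.inr i) * FreeAlgebra.ι K (Sum.inl j))
      (FreeAlgebra.ι K (Sum.inl j) * FreeAlgebra.ι K (Sum.inr i) + (if i = j then 1 else 0))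

/-- The Weyl algebra `K[x_1, …, x_d, ∂_1, …, ∂_d]`. -/
def WeylAlgebra : Type _ := RingQuot (WeylRel K d)

instance : Ring (WeylAlgebra K d) := inferInstanceAs (Ring (RingQuot (WeylRel K d)))

instance : Algebra K (WeylAlgebra K d) := inferInstanceAs (Algebra K (RingQuot (WeylRel K d)))

variable {d}

/-- The quotient map from the free algebra. -/
def weylMk : FreeAlgebra K (Fin d ⊕ Fin d) →ₐ[K] WeylAlgebra K d :=
  RingQuot.mkAlgHom K (WeylRel K d)

theorem weylMk_rel {a b : FreeAlgebra K (Fin d ⊕ Fin d)} (h : WeylRel K d a b) :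
    weylMk K a = weylMk K b :=
  RingQuot.mkAlgHom_rel K h

/-- The element `x_i` of the Weyl algebra. -/
def wx (i : Fin d) : WeylAlgebra K d :=
  weylMk K (FreeAlgebra.ι K (Sum.inl i))

/-- The element `∂_i` of the Weyl algebra. -/
def wd (i : Fin d) : WeylAlgebra K d :=
  weylMk K (FreeAlgebra.ι K (Sum.inr i))

theorem mulX_apply {E : Type*} [CommRing E] [Algebra K E] (i : Fin d) (g : LogSeries E d)
    (δ : Fin d → E) : mulX K i g δ = g (δ - Pi.single i 1) := rfl

theorem partialD_apply {E : Type*} [CommRing E] [Algebra K E] (i : Fin d) (g : LogSeries E d)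
    (δ : Fin d → E) : partialD K i g δ =
      (δ i + 1) • g (δ + Pi.single i 1) + MvPolynomial.pderiv i (g (δ + Pi.single i 1)) := rfl

theorem wx_comm (i j : Fin d) : wx K i * wx K j = wx K j * wx K i := by
  simpa [wx] using weylMk_rel K (WeylRel.x_comm (K := K) i j)

theorem wd_comm (i j : Fin d) : wd K i * wd K j = wd K j * wd K i := by
  simpa [wd] using weylMk_rel K (WeylRel.d_comm (K := K) i j)

theorem wd_wx (i j : Fin d) :
    wd K i * wx K j = wx K j * wd K i + (if i = j then 1 else 0) := by
  have h := weylMk_rel K (WeylRel.d_x (K := K) i j)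
  simp only [map_mul, map_add] at h
  rw [wd, wx, h]
  split_ifs <;> simp

/-- The algebra map out of the Weyl algebra given by images of the generators which satisfy the
defining relations. -/
def weylLift {A : Type*} [Ring A] [Algebra K A] (X D : Fin d → A)
    (hX : ∀ i j, X i * X j = X j * X i) (hD : ∀ i j, D i * D j = D j * D i)
    (hDX : ∀ i j, D i * X j = X j * D i + (if i = j then 1 else 0)) :
    WeylAlgebra K d →ₐ[K] A :=
  RingQuot.liftAlgHom K (s := WeylRel K d) ⟨FreeAlgebra.lift K (Sum.elim X D), by
    intro a b h
    induction h with
    | x_comm i j => simpa using hX i j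
    | d_comm i j => simpa using hD i j
    | d_x i j =>
      have := hDX i j
      split_ifs at this ⊢ <;> simpa using this⟩

theorem weylLift_weylMk {A : Type*} [Ring A] [Algebra K A] (X D : Fin d → A)
    (hX : ∀ i j, X i * X j = X j * X i) (hD : ∀ i j, D i * D j = D j * D i)
    (hDX : ∀ i j, D i * X j = X j * D i + (if i = j then 1 else 0))
    (a : FreeAlgebra K (Fin d ⊕ Fin d)) :
    weylLift K X D hX hD hDX (weylMk K a) = FreeAlgebra.lift K (Sum.elim X D) a :=
  RingQuot.liftAlgHom_mkAlgHom_apply ..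

/-- The Fourier-Laplace transform: the `K`-algebra map with `x_i ↦ -∂_i` and `∂_i ↦ x_i`. -/
def fourierLaplace : WeylAlgebra K d →ₐ[K] WeylAlgebra K d :=
  weylLift K (fun i => -wd K i) (fun i => wx K i)
    (fun i j => by rw [neg_mul_neg, neg_mul_neg, wd_comm])
    (fun i j => wx_comm K i j)
    (fun i j => by
      have h := wd_wx K j i
      rw [mul_neg, neg_mul, h]
      by_cases hij : i = j
      · subst hij; simp
      · simp [hij, Ne.symm hij])

theorem fourierLaplace_wx (i : Fin d) : fourierLaplace K (wx K i) = -wd K i := by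
  rw [fourierLaplace, wx, weylLift_weylMk]
  simp

theorem fourierLaplace_wd (i : Fin d) : fourierLaplace K (wd K i) = wx K i := by
  rw [fourierLaplace, wd, weylLift_weylMk]
  simp

variable {E : Type*} [CommRing E] [Algebra K E]

/-- The action of differential operators over `K` on formal series over a `K`-algebra `E`. -/
def weylAction : WeylAlgebra K d →ₐ[K] Module.End K (LogSeries E d) :=
  weylLift K (fun i => mulX K i) (fun i => partialD K i)
    (fun i j => by
      refine LinearMap.ext fun g => funext fun δ => ?_
      simp only [Module.End.mul_apply, mulX_apply]
      congr 1
      abel)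
    (fun i j => by
      refine LinearMap.ext fun g => funext fun δ => ?_
      by_cases hij : i = j
      · subst hij; rfl
      · have h1 : δ + Pi.single i 1 + Pi.single j 1 = δ + Pi.single j 1 + Pi.single i (1 : E) := by
          abel
        simp only [Module.End.mul_apply, partialD_apply, h1,
          Pi.add_apply, Pi.single_apply, hij, Ne.symm hij, if_false, add_zero, smul_add, map_add,
          Derivation.map_smul]
        rw [smul_comm (δ i + 1) (δ j + 1)]
        have h2 : ∀ P : MvPolynomial (Fin d) E, MvPolynomial.pderiv i (MvPolynomial.pderiv j P) =
            MvPolynomial.pderiv j (MvPolynomial.pderiv i P) := by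
          intro P
          have h3 : ⁅MvPolynomial.pderiv (R := E) i, MvPolynomial.pderiv j⁆ = 0 :=
            MvPolynomial.derivation_ext fun l => by
              rw [Derivation.commutator_apply]
              simp only [MvPolynomial.pderiv_X, Pi.single_apply]
              split_ifs <;> simp
          have h4 := congrArg (fun D => D P) h3
          simpa [Derivation.commutator_apply, sub_eq_zero] using h4
        rw [h2]
        abel)
    (fun i j => by
      refine LinearMap.ext fun g => funext fun δ => ?_
      by_cases hij : i = j
      · subst hij
        simp only [Module.End.mul_apply, mulX_apply, partialD_apply,
          LinearMap.add_apply, if_true, Module.End.one_apply, Pi.add_apply, add_sub_cancel_right,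
          sub_add_cancel, Pi.sub_apply, Pi.single_eq_same]
        rw [add_smul, one_smul]
        abel
      · have h1 : δ + Pi.single i 1 - Pi.single j 1 = δ - Pi.single j 1 + Pi.single i (1 : E) := by
          abel
        simp only [Module.End.mul_apply, mulX_apply, partialD_apply, hij,
          if_false, add_zero, h1, Pi.sub_apply,
          Pi.single_apply, sub_zero])

end Weyl

/-! ### The standard Laplace transform -/

/-- For `Re γ > -1` the classical transform is `𝓛(x^γ (log x)^k) = x^(-γ-1) Λ(log x)` with
`Λ = ∑_j binom(k, j) Γ^(j)(γ + 1) (-1)^(k-j) X^(k-j)`; this is the polynomial `Λ`. -/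
def classicalPoly (γ : ℂ) (k : ℕ) : Polynomial ℂ :=
  ∑ j ∈ Finset.range (k + 1),
    Polynomial.monomial (k - j)
      ((k.choose j : ℂ) * iteratedDeriv j Complex.Gamma (γ + 1) * (-1) ^ (k - j))

/-- The coefficient of `x^(γ+n+1) (log x)^ℓ` in
`F_{γ,k,n} = ∑_{m ≤ n} (-1)^m / (m! (n-m)!) · x^(γ+n+1) / (m+γ+1) ·
  ∑_{ℓ ≤ k} k! (-1)^(k-ℓ) / (ℓ! (m+γ+1)^(k-ℓ)) (log x)^ℓ`,
the iterated primitive of order `n + 1` of `x^γ (log x)^k`. -/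
def primitiveCoeff (γ : ℂ) (k n ℓ : ℕ) : ℂ :=
  ∑ m ∈ Finset.range (n + 1),
    (-1) ^ m / ((m.factorial : ℂ) * ((n - m).factorial : ℂ)) * (1 / ((m : ℂ) + γ + 1)) *
      ((k.factorial : ℂ) * (-1) ^ (k - ℓ) / ((ℓ.factorial : ℂ) * ((m : ℂ) + γ + 1) ^ (k - ℓ)))

/-- The transform of `x^γ (log x)^k` in one variable is `x^(-γ-1) Λ(log x)` for this polynomial
`Λ`: the classical one for `Re γ > -1`, and otherwise the one obtained by
`𝓛(x^γ (log x)^k) = x^(n+1) 𝓛(F_{γ,k,n})` with some `n > 0` such that `n ≥ -Re γ - 1` (the result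
does not depend on `n`). It is meaningful for `γ` not a negative integer. -/
def laplacePoly (γ : ℂ) (k : ℕ) : Polynomial ℂ :=
  if -1 < γ.re then classicalPoly γ k
  else
    let n : ℕ := ⌈-γ.re - 1⌉₊ + 1
    ∑ ℓ ∈ Finset.range (k + 1), primitiveCoeff γ k n ℓ • classicalPoly (γ + n + 1) ℓ

/-- The standard Laplace transform in several variables. The transform of the monomial
`x^δ (log x)^k` is the product of the one-variable transforms
`x_i^(-δ_i-1) Λ_{δ_i,k_i}(log x_i)`, extended `K`-linearly and to infinite sums; the terms with
exponent `δ` contribute exactly to the exponent `-δ-1`. It is meaningful on series all of whose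
exponents lie in `(K ∖ ℤ)^d`. -/
def laplace {K : Type*} [Field K] [Algebra K ℂ] {d : ℕ} (g : LogSeries K d) : LogSeries ℂ d :=
  Function.extend (fun (δ : Fin d → K) (i : Fin d) => -algebraMap K ℂ (δ i) - 1)
    (fun δ => ∑ k ∈ (g δ).support, algebraMap K ℂ (MvPolynomial.coeff k (g δ)) •
      ∏ i, Polynomial.aeval (MvPolynomial.X i : MvPolynomial (Fin d) ℂ)
        (laplacePoly (algebraMap K ℂ (δ i)) (k i))) 0

end LaplaceSeveral

end

noncomputable section

namespace LaplaceSeveral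

/-! ### The normalized absolute value as an absolute value -/

section AbsV

variable {K : Type*} [Field K] [NumberField K] (v : NumberField.FinitePlace K)

/-! The one-variable transform of x^δ (log x)^k is x^(-δ-1) Λ(log x), where Λ(X) is k! times the
coefficient of T^k in e^(-TX) Γ(δ + 1 + T): logarithms amount to differentiating Γ(δ + 1) x^(-δ-1)
in δ. For Re δ ≤ -1 the same formula results from the partial fractions of 1 / (a (a + 1) ⋯ (a + n))
(`coeff_laplacePoly`).

For δ = γ ± n the functional equation writes the Taylor series of Γ at δ + 1 as a jet over K, rising
or falling, times the Taylor series at γ. The second factor does not depend on n. After division by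
Γ(γ), the coefficient of (log x)^j is therefore a finite complex combination of series over K with
coefficients a_α times Taylor coefficients of these jets (`laplaceCoeffSeries_mem_span`). For j = k
only constant terms remain and Γ(γ) cancels (`laplaceCoeffSeries_self`).

The radii follow because γ (γ + 1) ⋯ (γ + n - 1) has v-adic size π_v^n up to polynomial factors in
n, which the |α|-th root kills. Its size is at most |n!|_v since γ is a limit of integers
(`prod_shift_le_factorial`). It is at least |n!|_v times a lower bound for its smallest factor
(`factorial_mul_le_prod_shift`), and the product formula makes that loss polynomial
(`polyGrowth_inv_absV_add_intCast`). Legendre's formula evaluates |n!|_v. Each further Taylor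
coefficient costs only another polynomial factor.

For differential operators, the transform turns x_i into -∂_i and ∂_i into x_i on series with
exponents off ℤ, and such series are stable under both (`laplace_weylAction`). -/

theorem absV_exponent_pos :
    0 < Real.logb (v (residuePrime v : K)) ((residuePrime v : ℝ)⁻¹) := by
  have hp := (residuePrime_prime v)
  have h0 : 0 < v (residuePrime v : K) := by
    rw [NumberField.FinitePlace.pos_iff]
    exact_mod_cast hp.ne_zero
  refine Real.logb_pos_of_base_lt_one h0 (apply_residuePrime_lt_one v) ?_ ?_
  · have := hp.pos
    positivity
  · exact inv_lt_one_of_one_lt₀ (by exact_mod_cast hp.one_lt)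

theorem absV_add_le_max (x y : K) : absV v (x + y) ≤ max (absV v x) (absV v y) := by
  have hc := (absV_exponent_pos v).le
  rcases le_total (v x) (v y) with h | h
  · refine le_max_of_le_right (Real.rpow_le_rpow (apply_nonneg v _) ?_ hc)
    exact (NumberField.FinitePlace.add_le v x y).trans (max_le h le_rfl)
  · refine le_max_of_le_left (Real.rpow_le_rpow (apply_nonneg v _) ?_ hc)
    exact (NumberField.FinitePlace.add_le v x y).trans (max_le le_rfl h)

/-- The normalized absolute value `absV v` as a bundled absolute value. -/
def placeAbs : AbsoluteValue K ℝ where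
  toFun := absV v
  map_mul' x y := by
    simp only [absV, map_mul]
    exact Real.mul_rpow (apply_nonneg v _) (apply_nonneg v _)
  nonneg' x := Real.rpow_nonneg (apply_nonneg v _) _
  eq_zero' x := by
    rw [absV, Real.rpow_eq_zero (apply_nonneg v x) (absV_exponent_pos v).ne', map_eq_zero]
  add_le' x y := (absV_add_le_max v x y).trans <| max_le_add_of_nonneg
    (Real.rpow_nonneg (apply_nonneg v _) _) (Real.rpow_nonneg (apply_nonneg v _) _)

theorem placeAbs_apply (x : K) : placeAbs v x = absV v x := rfl

theorem isNonarchimedean_placeAbs : IsNonarchimedean (placeAbs v) := absV_add_le_max v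

end AbsV

/-! ### Comparison of radii of convergence -/

section Radius

variable {K : Type*} [Field K] [NumberField K] {d : ℕ}

theorem tendsto_degree_cofinite :
    Tendsto (fun α : Fin d →₀ ℕ => (α.degree : ℝ)) cofinite atTop := by
  refine tendsto_natCast_atTop_atTop.comp (tendsto_atTop.2 fun n => ?_)
  rw [eventually_cofinite]
  refine (Finsupp.finite_of_degree_le n).subset fun α hα => ?_
  simp only [not_le, Set.mem_ofPred_eq] at hα ⊢
  exact hα.le

/-- This is why all later estimates may lose polynomial factors: they do not affect a radius of
convergence. -/
theorem tendsto_polynomial_geometric_root {C ρ : ℝ} (hC : 0 < C) (hρ : 0 < ρ) (D : ℕ) :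
    Tendsto (fun α : Fin d →₀ ℕ =>
      (C * ((α.degree : ℝ) + 1) ^ D * ρ ^ α.degree) ^ (1 / (α.degree : ℝ))) cofinite
      (nhds ρ) := by
  -- The second exponent is D / x, written in the shape that `tendsto_rpow_div_mul_add` gives at x +
  -- 1.
  have h1 : Tendsto (fun x : ℝ => C ^ (1 / x) * (x + 1) ^ ((D : ℝ) / (1 * (x + 1) + (-1))) * ρ)
      atTop (nhds (C ^ (0 : ℝ) * 1 * ρ)) := by
    refine Tendsto.mul_const _ (Tendsto.mul ?_ ?_)
    · refine Filter.Tendsto.rpow tendsto_const_nhds ?_ (Or.inl hC.ne')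
      exact tendsto_const_nhds.div_atTop tendsto_id
    · exact (tendsto_rpow_div_mul_add D 1 (-1) (by norm_num)).comp
        (tendsto_atTop_add_const_right _ 1 tendsto_id)
  rw [Real.rpow_zero, one_mul, one_mul] at h1
  refine (h1.comp (tendsto_degree_cofinite (d := d))).congr' ?_
  filter_upwards [tendsto_degree_cofinite.eventually (eventually_ge_atTop (1 : ℝ))] with α hα
  have h0 : (α.degree : ℝ) ≠ 0 := by positivity
  simp only [Function.comp]
  rw [Real.mul_rpow (by positivity) (by positivity), Real.mul_rpow hC.le (by positivity),
    ← Real.rpow_natCast ρ, ← Real.rpow_mul hρ.le, mul_one_div_cancel h0, Real.rpow_one,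
    ← Real.rpow_natCast _ D, ← Real.rpow_mul (by positivity)]
  congr 3
  ring

/-! ### Polynomial growth -/

/-- `g` is at most a polynomial in the size function `s`. -/
def PolyGrowth {ι : Type*} (s : ι → ℕ) (g : ι → ℝ) : Prop :=
  ∃ C : ℝ, 0 < C ∧ ∃ D : ℕ, ∀ i, g i ≤ C * ((s i : ℝ) + 1) ^ D

namespace PolyGrowth

variable {ι κ : Type*} {s : ι → ℕ} {g h : ι → ℝ}

theorem mono (hg : PolyGrowth s g) (hh : ∀ i, h i ≤ g i) : PolyGrowth s h := by
  obtain ⟨C, hC, D, H⟩ := hg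
  exact ⟨C, hC, D, fun i => (hh i).trans (H i)⟩

theorem const (s : ι → ℕ) (c : ℝ) : PolyGrowth s fun _ => c :=
  ⟨max c 1, by positivity, 0, fun i => by simp⟩

theorem size_add_one (s : ι → ℕ) : PolyGrowth s fun i => (s i : ℝ) + 1 :=
  ⟨1, one_pos, 1, fun i => by simp⟩

theorem mul (hg : PolyGrowth s g) (hh : PolyGrowth s h) (h0 : ∀ i, 0 ≤ h i) :
    PolyGrowth s fun i => g i * h i := by
  obtain ⟨C, hC, D, H⟩ := hg
  obtain ⟨C', hC', D', H'⟩ := hh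
  refine ⟨C * C', by positivity, D + D', fun i => ?_⟩
  calc g i * h i ≤ (C * ((s i : ℝ) + 1) ^ D) * (C' * ((s i : ℝ) + 1) ^ D') :=
        mul_le_mul (H i) (H' i) (h0 i) (by positivity)
    _ = _ := by ring

theorem pow (hg : PolyGrowth s g) (h0 : ∀ i, 0 ≤ g i) (n : ℕ) :
    PolyGrowth s fun i => g i ^ n := by
  induction n with
  | zero => simpa using const s 1
  | succ n ih => simpa only [pow_succ] using ih.mul hg h0

theorem prod {t : Finset κ} {g : κ → ι → ℝ} (hg : ∀ j ∈ t, PolyGrowth s (g j))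
    (h0 : ∀ j i, 0 ≤ g j i) : PolyGrowth s fun i => ∏ j ∈ t, g j i := by
  classical
  induction t using Finset.induction_on with
  | empty => simpa using const s 1
  | insert a t ha ih =>
    simp only [Finset.prod_insert ha]
    exact (hg a (Finset.mem_insert_self a t)).mul
      (ih fun j hj => hg j (Finset.mem_insert_of_mem hj)) fun i =>
        Finset.prod_nonneg fun j _ => h0 j i

theorem comp (hg : PolyGrowth s g) {s' : κ → ℕ} {t : κ → ι} (ht : ∀ j, s (t j) ≤ s' j) :
    PolyGrowth s' fun j => g (t j) := by
  obtain ⟨C, hC, D, H⟩ := hg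
  refine ⟨C, hC, D, fun j => (H _).trans ?_⟩
  have : (s (t j) : ℝ) ≤ s' j := by exact_mod_cast ht j
  gcongr

theorem of_succ {g : ℕ → ℝ} (hg : PolyGrowth id g) : PolyGrowth id fun n => g (n + 1) := by
  obtain ⟨C, hC, D, H⟩ := hg
  -- The constant comes from n + 2 ≤ 2 (n + 1).
  refine ⟨C * 2 ^ D, by positivity, D, fun n => (H _).trans ?_⟩
  rw [mul_assoc, ← mul_pow]
  simp only [id]
  push_cast
  gcongr
  linarith [(Nat.cast_nonneg n : (0 : ℝ) ≤ n)]

end PolyGrowth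

/-- If the coefficients of `y` are at most those of `f` times a quantity which grows like `ρ ^ |α|`
up to a polynomial in `|α|`, then the radius of `y` is at least that of `f` times `ρ⁻¹`. -/
theorem radius_mul_le_radius (hd : 0 < d) (v : NumberField.FinitePlace K)
    {f y : MvPowerSeries (Fin d) K} {ρ : ℝ} (hρ : 0 < ρ) {g : (Fin d →₀ ℕ) → ℝ}
    (hg : PolyGrowth Finsupp.degree g)
    (hfy : ∀ α, absV v (MvPowerSeries.coeff α y) ≤
      absV v (MvPowerSeries.coeff α f) * (g α * ρ ^ α.degree)) :
    radius v f * ENNReal.ofReal ρ⁻¹ ≤ radius v y := by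
  obtain ⟨C, hC, D, hg⟩ := hg
  have h0 : ∀ x, 0 ≤ absV v x := (placeAbs v).nonneg
  have h : ∀ α, absV v (MvPowerSeries.coeff α y) ≤
      absV v (MvPowerSeries.coeff α f) * (C * ((α.degree : ℝ) + 1) ^ D * ρ ^ α.degree) :=
    fun α => (hfy α).trans (mul_le_mul_of_nonneg_left
      (mul_le_mul_of_nonneg_right (hg α) (by positivity)) (h0 _))
  -- This makes the set of multi-indices infinite, so that `cofinite` is a proper filter and the
  -- limit is the limsup.
  have : Nonempty (Fin d) := ⟨⟨0, hd⟩⟩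
  have hlim := ENNReal.tendsto_ofReal (tendsto_polynomial_geometric_root (d := d) hC hρ D)
  have hρ0 : ENNReal.ofReal ρ ≠ 0 := by simpa using hρ
  have hlimsup := hlim.limsup_eq
  rw [ENNReal.ofReal_inv_of_pos hρ, radius, radius,
    ← ENNReal.mul_inv (Or.inr ENNReal.ofReal_ne_top) (Or.inr hρ0), ENNReal.inv_le_inv]
  -- The side conditions exclude 0 · ∞; they hold because the second factor tends to ρ, which is
  -- neither 0 nor ∞.
  have hmul := ENNReal.limsup_mul_le' (f := cofinite) (u := fun α : Fin d →₀ ℕ =>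
      ENNReal.ofReal (absV v (MvPowerSeries.coeff α f) ^ (1 / (α.degree : ℝ))))
    (v := fun α => ENNReal.ofReal
      ((C * ((α.degree : ℝ) + 1) ^ D * ρ ^ α.degree) ^ (1 / (α.degree : ℝ))))
    (Or.inr (hlimsup.trans_ne ENNReal.ofReal_ne_top)) (Or.inr (hlimsup.trans_ne hρ0))
  rw [hlimsup] at hmul
  refine le_trans ?_ hmul
  refine limsup_le_limsup (Eventually.of_forall fun α => ?_)
  rw [Pi.mul_apply, ← ENNReal.ofReal_mul (Real.rpow_nonneg (h0 _) _),
    ← Real.mul_rpow (h0 _) (by positivity)]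
  exact ENNReal.ofReal_le_ofReal (Real.rpow_le_rpow (h0 _) (h α) (by positivity))

/-- If the coefficients of `y` and `f` are comparable up to a factor `ρ ^ |α|` and polynomials in
`|α|`, then the radius of `y` is that of `f` times `ρ⁻¹`. -/
theorem radius_eq_radius_mul (hd : 0 < d) (v : NumberField.FinitePlace K)
    {f y : MvPowerSeries (Fin d) K} {ρ : ℝ} (hρ : 0 < ρ) {g g' : (Fin d →₀ ℕ) → ℝ}
    (hg : PolyGrowth Finsupp.degree g) (hg' : PolyGrowth Finsupp.degree g')
    (h : ∀ α, absV v (MvPowerSeries.coeff α y) ≤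
      absV v (MvPowerSeries.coeff α f) * (g α * ρ ^ α.degree))
    (h' : ∀ α, absV v (MvPowerSeries.coeff α f) ≤
      absV v (MvPowerSeries.coeff α y) * (g' α * ρ⁻¹ ^ α.degree)) :
    radius v y = radius v f * ENNReal.ofReal ρ⁻¹ := by
  refine le_antisymm ?_ (radius_mul_le_radius hd v hρ hg h)
  have h2 := radius_mul_le_radius hd v (inv_pos.2 hρ) hg' h'
  rw [inv_inv] at h2
  have hρ0 : ENNReal.ofReal ρ ≠ 0 := by simpa using hρ
  calc radius v y = radius v y * ENNReal.ofReal ρ * ENNReal.ofReal ρ⁻¹ := by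
        rw [mul_assoc, ENNReal.ofReal_inv_of_pos hρ, ENNReal.mul_inv_cancel hρ0
          ENNReal.ofReal_ne_top, mul_one]
    _ ≤ _ := by gcongr

end Radius

/-! ### Products of shifts for a nonarchimedean absolute value -/

section Shifts

variable {K : Type*} [Field K] {w : AbsoluteValue K ℝ}

theorem abs_natCast_le_of_dvd (hw : IsNonarchimedean w) {a b : ℕ} (h : a ∣ b) :
    w (b : K) ≤ w (a : K) := by
  obtain ⟨c, rfl⟩ := h
  rw [Nat.cast_mul, map_mul]
  exact mul_le_of_le_one_right (w.nonneg _) (hw.apply_natCast_le_one)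

/-- Let m₀ minimize |γ + m|. The ultrametric inequality gives |m - m₀| ≤ |γ + m| for every m, so the
factors other than m₀ contribute at least |m₀! (n - 1 - m₀)!|. As m₀! (n - 1 - m₀)! divides n!, this
is at least |n!|. The constant c accounts for the factor m₀. -/
theorem factorial_mul_le_prod_shift (hw : IsNonarchimedean w) {γ : K} {n : ℕ} {c : ℝ}
    (hc0 : 0 ≤ c) (hc1 : c ≤ 1) (hc : ∀ m < n, c ≤ w (γ + m)) :
    c * w (n.factorial : K) ≤ ∏ m ∈ Finset.range n, w (γ + m) := by
  rcases Nat.eq_zero_or_pos n with rfl | hn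
  · simpa using hc1
  obtain ⟨m₀, hm₀, hmin⟩ := Finset.exists_min_image (Finset.range n) (fun m : ℕ => w (γ + m))
    ⟨0, by simpa using hn⟩
  simp only [Finset.mem_range] at hm₀ hmin
  have hdiff : ∀ m < n, w ((m : K) - m₀) ≤ w (γ + m) := fun m hm => by
    have h1 := hw (γ + m) (-(γ + m₀))
    rwa [w.map_neg, max_eq_left (hmin m hm),
      show γ + (m : K) + -(γ + m₀) = (m : K) - m₀ by ring] at h1
  obtain ⟨t, rfl⟩ : ∃ t, n = m₀ + (t + 1) := ⟨n - m₀ - 1, by omega⟩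
  have h1 : w (m₀.factorial : K) ≤ ∏ m ∈ Finset.range m₀, w (γ + m) := by
    rw [← Finset.prod_range_add_one_eq_factorial, ← Finset.prod_range_reflect, Nat.cast_prod,
      map_prod]
    refine Finset.prod_le_prod (fun _ _ => w.nonneg _) fun m hm => ?_
    have hm' := Finset.mem_range.1 hm
    refine le_trans (le_of_eq ?_) (hdiff m (by omega))
    rw [show m₀ - 1 - m + 1 = m₀ - m by omega, Nat.cast_sub hm'.le, w.map_sub]
  have h2 : w (t.factorial : K) ≤ ∏ m ∈ Finset.range t, w (γ + (m₀ + (m + 1) : ℕ)) := by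
    rw [← Finset.prod_range_add_one_eq_factorial, Nat.cast_prod, map_prod]
    refine Finset.prod_le_prod (fun _ _ => w.nonneg _) fun m hm => ?_
    have hm' := Finset.mem_range.1 hm
    refine le_trans (le_of_eq ?_) (hdiff (m₀ + (m + 1)) (by omega))
    push_cast
    ring_nf
  rw [Finset.prod_range_add, Finset.prod_range_succ']
  calc c * w ((m₀ + (t + 1)).factorial : K) ≤ c * w ((m₀.factorial * t.factorial : ℕ) : K) := by
        refine mul_le_mul_of_nonneg_left (abs_natCast_le_of_dvd hw ?_) hc0
        exact (mul_dvd_mul_left _ (Nat.factorial_dvd_factorial t.le_succ)).trans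
          (Nat.factorial_mul_factorial_dvd_factorial_add _ _)
    _ = w (m₀.factorial : K) * (w (t.factorial : K) * c) := by
        rw [Nat.cast_mul, map_mul]; ring
    _ ≤ _ := by
        refine mul_le_mul h1 (mul_le_mul h2 (hc m₀ hm₀) hc0 ?_)
          (mul_nonneg (w.nonneg _) hc0) ?_ <;>
        exact Finset.prod_nonneg fun _ _ => w.nonneg _

/-- Replace γ by an integer N so close that no factor gets smaller; then n! divides N (N + 1) ⋯ (N +
n - 1). Such an N exists once no factor is 0, which is why that case is split off. -/
theorem prod_shift_le_factorial (hw : IsNonarchimedean w) {γ : K}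
    (hγ : ∀ ε : ℝ, 0 < ε → ∃ N : ℤ, w (γ - N) < ε) (n : ℕ) :
    ∏ m ∈ Finset.range n, w (γ + m) ≤ w (n.factorial : K) := by
  by_cases h0 : ∃ m ∈ Finset.range n, w (γ + (m : ℕ)) = 0
  · obtain ⟨m, hm, h⟩ := h0
    rw [Finset.prod_eq_zero hm h]
    exact w.nonneg _
  push Not at h0
  obtain ⟨N, hN⟩ : ∃ N : ℤ, ∀ m ∈ Finset.range n, w (γ - N) < w (γ + m) := by
    rcases Nat.eq_zero_or_pos n with rfl | hn
    · exact ⟨0, by simp⟩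
    obtain ⟨m₀, hm₀, hmin⟩ := Finset.exists_min_image (Finset.range n)
      (fun m : ℕ => w (γ + m)) ⟨0, by simpa using hn⟩
    obtain ⟨N, hN⟩ := hγ _ ((w.nonneg _).lt_of_ne (h0 m₀ hm₀).symm)
    exact ⟨N, fun m hm => hN.trans_le (hmin m hm)⟩
  obtain ⟨q, hq⟩ := Nat.factorial_coe_dvd_prod n N
  calc ∏ m ∈ Finset.range n, w (γ + m) ≤ ∏ m ∈ Finset.range n, w ((N : K) + m) := by
        refine Finset.prod_le_prod (fun _ _ => w.nonneg _) fun m hm => ?_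
        have h1 := hw (N + m : K) (γ - N)
        rw [show (N + m : K) + (γ - N) = γ + m by ring] at h1
        exact (le_max_iff.1 h1).resolve_right (hN m hm).not_ge
    _ = w (n.factorial : K) * w (q : K) := by
        rw [← map_prod, ← map_mul]
        congr 1
        have hq' := congrArg (Int.cast (R := K)) hq
        push_cast at hq'
        exact hq'
    _ ≤ _ := mul_le_of_le_one_right (w.nonneg _) (hw.apply_intCast_le_one)

end Shifts

/-! ### Factorials at a finite place -/

section Factorial

variable {K : Type*} [Field K] [NumberField K] (v : NumberField.FinitePlace K)

theorem piV_eq : piV v = (residuePrime v : ℝ) ^ (-(1 / ((residuePrime v : ℝ) - 1))) := by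
  rw [piV, absV_residuePrime, Real.inv_rpow (Nat.cast_nonneg _), Real.rpow_neg (Nat.cast_nonneg _)]

theorem piV_pos : 0 < piV v := by
  rw [piV_eq]
  have := (residuePrime_prime v).pos
  positivity

/-- By Bézout 1 = a m + b p; if |m|_v < 1, both terms would have absolute value below 1. -/
theorem absV_natCast_of_not_dvd {m : ℕ} (hm : ¬ residuePrime v ∣ m) : absV v (m : K) = 1 := by
  have hp := residuePrime_prime v
  have hw := isNonarchimedean_placeAbs v
  have hcop : IsCoprime (m : ℤ) (residuePrime v : ℤ) :=
    Nat.isCoprime_iff_coprime.2 ((Nat.Prime.coprime_iff_not_dvd hp).2 hm).symm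
  obtain ⟨a, b, hab⟩ := hcop
  have hab' : (a : K) * m + b * residuePrime v = 1 := by exact_mod_cast congrArg (Int.cast (R := K)) hab
  refine le_antisymm (hw.apply_natCast_le_one) ?_
  by_contra! hlt
  have hp1 : placeAbs v (residuePrime v : K) < 1 := by
    rw [placeAbs_apply, absV_residuePrime]
    exact inv_lt_one_of_one_lt₀ (by exact_mod_cast hp.one_lt)
  have h := hw ((a : K) * m) (b * residuePrime v)
  rw [hab', map_one, map_mul, map_mul] at h
  have h1 : placeAbs v (a : K) * placeAbs v (m : K) < 1 :=
    (mul_le_of_le_one_left ((placeAbs v).nonneg _) (hw.apply_intCast_le_one)).trans_lt hlt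
  have h2 : placeAbs v (b : K) * placeAbs v (residuePrime v : K) < 1 :=
    (mul_le_of_le_one_left ((placeAbs v).nonneg _) (hw.apply_intCast_le_one)).trans_lt hp1
  exact absurd h (max_lt h1 h2).not_ge

theorem absV_natCast {m : ℕ} (hm : m ≠ 0) :
    absV v (m : K) = (residuePrime v : ℝ) ^ (-(padicValNat (residuePrime v) m : ℝ)) := by
  have hp := residuePrime_prime v
  have : Fact (residuePrime v).Prime := ⟨hp⟩
  obtain ⟨e, m', hm', rfl⟩ := Nat.exists_eq_pow_mul_and_not_dvd hm _ hp.ne_one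
  have hm0 : m' ≠ 0 := by rintro rfl; simp at hm'
  rw [padicValNat.mul (pow_ne_zero _ hp.ne_zero) hm0, padicValNat.prime_pow,
    padicValNat.eq_zero_of_not_dvd hm', add_zero, ← placeAbs_apply, Nat.cast_mul, map_mul,
    Nat.cast_pow, map_pow, placeAbs_apply, placeAbs_apply, absV_natCast_of_not_dvd v hm',
    absV_residuePrime, mul_one, Real.rpow_neg (Nat.cast_nonneg _), Real.rpow_natCast, inv_pow]

/-- Legendre's formula: (p - 1) ord_p(n!) is n minus the sum of the base p digits of n. -/
theorem absV_factorial (n : ℕ) :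
    absV v (n.factorial : K) = piV v ^ n *
      (residuePrime v : ℝ) ^ ((((residuePrime v).digits n).sum : ℝ) / ((residuePrime v : ℝ) - 1)) := by
  have hp := residuePrime_prime v
  have : Fact (residuePrime v).Prime := ⟨hp⟩
  have hp0 : (0 : ℝ) < residuePrime v := by exact_mod_cast hp.pos
  have hp1 : (0 : ℝ) < (residuePrime v : ℝ) - 1 := by
    rw [sub_pos]; exact_mod_cast hp.one_lt
  have hleg := sub_one_mul_padicValNat_factorial (p := residuePrime v) n
  have hleg' : ((residuePrime v : ℝ) - 1) * padicValNat (residuePrime v) n.factorial =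
      n - ((residuePrime v).digits n).sum := by
    have := congrArg (Nat.cast (R := ℝ)) hleg
    rwa [Nat.cast_mul, Nat.cast_sub (Nat.digit_sum_le _ n), Nat.cast_sub hp.one_le,
      Nat.cast_one] at this
  rw [absV_natCast v n.factorial_ne_zero, piV_eq, ← Real.rpow_natCast, ← Real.rpow_mul hp0.le,
    ← Real.rpow_add hp0]
  congr 1
  field_simp
  linarith

theorem piV_pow_le_absV_factorial (n : ℕ) : piV v ^ n ≤ absV v (n.factorial : K) := by
  have hp := residuePrime_prime v
  have hp1 : (1 : ℝ) < residuePrime v := by exact_mod_cast hp.one_lt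
  rw [absV_factorial]
  refine le_mul_of_one_le_right (pow_nonneg (piV_pos v).le _) (Real.one_le_rpow hp1.le ?_)
  exact div_nonneg (Nat.cast_nonneg _) (by linarith)

/-- Digits are at most p - 1, so the correction factor is at most p to the number of digits of n,
hence at most p n when n > 0. -/
theorem absV_factorial_le (n : ℕ) :
    absV v (n.factorial : K) ≤ piV v ^ n * (residuePrime v * ((n : ℝ) + 1)) := by
  have hp := residuePrime_prime v
  have hp1 : (1 : ℝ) < residuePrime v := by exact_mod_cast hp.one_lt
  rw [absV_factorial]
  refine mul_le_mul_of_nonneg_left ?_ (pow_nonneg (piV_pos v).le _)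
  rcases Nat.eq_zero_or_pos n with rfl | hn
  · simpa using hp1.le
  have hsum : ((residuePrime v).digits n).sum ≤
      ((residuePrime v).digits n).length * (residuePrime v - 1) := by
    rw [← smul_eq_mul]
    exact List.sum_le_card_nsmul _ _ fun x hx => Nat.le_sub_one_of_lt (Nat.digits_lt_base hp.one_lt hx)
  have hsum' : (((residuePrime v).digits n).sum : ℝ) ≤
      ((residuePrime v).digits n).length * ((residuePrime v : ℝ) - 1) := by
    have := (Nat.cast_le (α := ℝ)).2 hsum
    rwa [Nat.cast_mul, Nat.cast_sub hp.one_le, Nat.cast_one] at this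
  calc (residuePrime v : ℝ) ^ ((((residuePrime v).digits n).sum : ℝ) / ((residuePrime v : ℝ) - 1))
      ≤ (residuePrime v : ℝ) ^ (((residuePrime v).digits n).length : ℝ) := by
        refine Real.rpow_le_rpow_of_exponent_le hp1.le ?_
        rwa [div_le_iff₀ (by linarith)]
    _ = ((residuePrime v ^ ((residuePrime v).digits n).length : ℕ) : ℝ) := by
        rw [Real.rpow_natCast, Nat.cast_pow]
    _ ≤ ((residuePrime v * n : ℕ) : ℝ) := by
        exact_mod_cast Nat.base_pow_length_digits_le _ _ hp.one_lt hn.ne'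
    _ ≤ _ := by
        push_cast
        gcongr
        linarith

end Factorial

/-! ### A Liouville inequality -/

section Liouville

theorem PolyGrowth.rpow {ι : Type*} {s : ι → ℕ} {g : ι → ℝ} (hg : PolyGrowth s g)
    (h0 : ∀ i, 0 ≤ g i) {c : ℝ} (hc : 0 ≤ c) : PolyGrowth s fun i => g i ^ c := by
  obtain ⟨C, hC, D, H⟩ := hg
  refine ⟨C ^ c, by positivity, ⌈D * c⌉₊, fun i => ?_⟩
  calc g i ^ c ≤ (C * ((s i : ℝ) + 1) ^ D) ^ c := Real.rpow_le_rpow (h0 i) (H i) hc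
    _ = C ^ c * ((s i : ℝ) + 1) ^ (D * c) := by
      rw [Real.mul_rpow hC.le (by positivity), ← Real.rpow_natCast, ← Real.rpow_mul (by positivity)]
    _ ≤ C ^ c * ((s i : ℝ) + 1) ^ ((⌈D * c⌉₊ : ℕ) : ℝ) := by
      refine mul_le_mul_of_nonneg_left ?_ (by positivity)
      exact Real.rpow_le_rpow_of_exponent_le (by simp) (Nat.le_ceil _)
    _ = _ := by rw [Real.rpow_natCast]

variable {K : Type*} [Field K] [NumberField K] (v : NumberField.FinitePlace K)

/-- Product formula: at an algebraic integer the other finite places contribute at most 1. -/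
theorem inv_apply_le_prod_infinitePlace {x : 𝓞 K} (hx : x ≠ 0) :
    (v (x : K))⁻¹ ≤ ∏ u : NumberField.InfinitePlace K, u (x : K) ^ u.mult := by
  have hx' : (x : K) ≠ 0 := by simpa using hx
  have hle : ∀ u : NumberField.FinitePlace K, u (x : K) ≤ 1 := fun u => by
    rw [← NumberField.FinitePlace.norm_embedding_eq]
    exact NumberField.FinitePlace.norm_le_one K _ x
  have hfin : ∏ᶠ u : NumberField.FinitePlace K, u (x : K) ≤ v (x : K) := by
    have hs := NumberField.FinitePlace.hasFiniteMulSupport hx'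
    classical
    -- The place v is inserted by hand, since x may be a unit there and v then lies outside the
    -- multiplicative support.
    rw [finprod_eq_prod_of_mulSupport_subset (s := insert v hs.toFinset) _ (by
      intro u hu
      rw [Finset.coe_insert]
      exact Set.mem_insert_of_mem _ (hs.mem_toFinset.2 hu))]
    rw [← Finset.mul_prod_erase _ _ (Finset.mem_insert_self v _)]
    exact mul_le_of_le_one_right (apply_nonneg v _)
      (Finset.prod_le_one (fun u _ => apply_nonneg u _) fun u _ => hle u)
  have hprod := NumberField.prod_abs_eq_one hx'
  have hv : 0 < v (x : K) := NumberField.FinitePlace.pos_iff.2 hx'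
  rw [inv_le_iff_one_le_mul₀ hv, ← hprod]
  exact mul_le_mul_of_nonneg_left hfin
    (Finset.prod_nonneg fun u _ => pow_nonneg (apply_nonneg u _) _)

/-- Write γ = b / a with integral a and b. Then b + m a is a nonzero algebraic integer whose
archimedean absolute values are at most linear in m, so the product formula bounds it from below at
v. Passing back to γ + m only helps, because |a|_v ≤ 1. -/
theorem polyGrowth_inv_absV_add_intCast {γ : K} (hγ : ∀ n : ℤ, γ ≠ n) :
    PolyGrowth Int.natAbs fun m : ℤ => (absV v (γ + m))⁻¹ := by
  obtain ⟨b, a, ha, rfl⟩ := IsFractionRing.div_surjective (𝓞 K) γ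
  have ha0 : (a : K) ≠ 0 := by simpa using nonZeroDivisors.ne_zero ha
  have hx : ∀ m : ℤ, b + m * a ≠ 0 := fun m h => hγ (-m) <| by
    have h' : (b : K) + m * a = 0 := by simpa using congrArg (algebraMap (𝓞 K) K) h
    rw [div_eq_iff ha0]
    push_cast
    linear_combination h'
  have hinf : PolyGrowth Int.natAbs fun m : ℤ =>
      ∏ u : NumberField.InfinitePlace K, u ((b + m * a : 𝓞 K) : K) ^ u.mult := by
    refine PolyGrowth.prod (fun u _ => PolyGrowth.pow ?_ (fun _ => apply_nonneg u _) _)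
      fun u m => pow_nonneg (apply_nonneg u _) _
    refine (((PolyGrowth.const _ (u (b : K) + u (a : K))).mul
      (PolyGrowth.size_add_one Int.natAbs) fun _ => by positivity)).mono fun m => ?_
    have h1 : u ((b + m * a : 𝓞 K) : K) ≤ u (b : K) + m.natAbs * u (a : K) := by
      have h2 : ((b + m * a : 𝓞 K) : K) = b + m * a := by simp
      rw [h2]
      refine (u.1.add_le _ _).trans ?_
      rw [map_mul]
      refine add_le_add le_rfl (mul_le_mul_of_nonneg_right (le_of_eq ?_) (apply_nonneg u _))
      have := u.norm_embedding_eq (m : K)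
      exact this.symm.trans (by
        rw [map_intCast, Complex.norm_intCast, Nat.cast_natAbs, Int.cast_abs])
    have ha' := apply_nonneg u (a : K)
    have hb' := apply_nonneg u (b : K)
    nlinarith [(Nat.cast_nonneg m.natAbs : (0 : ℝ) ≤ m.natAbs)]
  refine (hinf.rpow (fun m => Finset.prod_nonneg fun u _ => pow_nonneg (apply_nonneg u _) _)
    (absV_exponent_pos v).le).mono fun m => ?_
  rw [absV, ← Real.inv_rpow (apply_nonneg v _)]
  refine Real.rpow_le_rpow (inv_nonneg.2 (apply_nonneg v _))
    (le_trans ?_ (inv_apply_le_prod_infinitePlace v (hx m))) (absV_exponent_pos v).le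
  have hva : v (a : K) ≤ 1 := by
    rw [← NumberField.FinitePlace.norm_embedding_eq]
    exact NumberField.FinitePlace.norm_le_one K _ a
  have h2 : ((b + m * a : 𝓞 K) : K) = (algebraMap (𝓞 K) K b / algebraMap (𝓞 K) K a + m) * a := by
    have h3 : ((b + m * a : 𝓞 K) : K) = b + m * a := by simp
    rw [h3]
    field_simp
  rw [h2, map_mul]
  have hx0 : 0 < v (algebraMap (𝓞 K) K b / algebraMap (𝓞 K) K a + m) := by
    rw [NumberField.FinitePlace.pos_iff]
    intro h
    refine hx m ?_
    have h4 : ((b + m * a : 𝓞 K) : K) = 0 := by rw [h2, h, zero_mul]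
    exact_mod_cast h4
  have ha1 : 0 < v (a : K) := NumberField.FinitePlace.pos_iff.2 ha0
  exact inv_anti₀ (by positivity) (mul_le_of_le_one_right hx0.le hva)

end Liouville

/-! ### Power series with geometrically bounded coefficients -/

section CoeffBound

variable {K : Type*} [Field K] {w : AbsoluteValue K ℝ}

theorem abs_sum_le_of_forall_le (hw : IsNonarchimedean w) {ι : Type*} {s : Finset ι} {f : ι → K}
    {M : ℝ} (hM : 0 ≤ M) (h : ∀ i ∈ s, w (f i) ≤ M) : w (∑ i ∈ s, f i) ≤ M := by
  classical
  induction s using Finset.induction_on with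
  | empty => simpa using hM
  | insert a s ha ih =>
    rw [Finset.sum_insert ha]
    exact (hw _ _).trans (max_le (h a (Finset.mem_insert_self a s))
      (ih fun i hi => h i (Finset.mem_insert_of_mem hi)))

/-- The coefficient of degree `r` of `u` is at most `c * B ^ r`. -/
def CoeffBound (w : AbsoluteValue K ℝ) (c B : ℝ) (u : PowerSeries K) : Prop :=
  ∀ r, w (PowerSeries.coeff r u) ≤ c * B ^ r

namespace CoeffBound

variable {c c' B : ℝ} {u u' : PowerSeries K}

theorem nonneg (h : CoeffBound w c B u) : 0 ≤ c := by
  simpa using (w.nonneg _).trans (h 0)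

theorem mul (hw : IsNonarchimedean w) (hB : 0 ≤ B) (h : CoeffBound w c B u)
    (h' : CoeffBound w c' B u') : CoeffBound w (c * c') B (u * u') := by
  intro r
  rw [PowerSeries.coeff_mul]
  refine abs_sum_le_of_forall_le hw ?_ fun p hp => ?_
  · exact mul_nonneg (mul_nonneg h.nonneg h'.nonneg) (pow_nonneg hB _)
  · rw [map_mul, ← Finset.HasAntidiagonal.mem_antidiagonal.1 hp]
    calc _ ≤ (c * B ^ p.1) * (c' * B ^ p.2) :=
          mul_le_mul (h _) (h' _) (w.nonneg _) (mul_nonneg h.nonneg (pow_nonneg hB _))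
      _ = _ := by ring

theorem one (hB : 0 ≤ B) : CoeffBound w 1 B (1 : PowerSeries K) := by
  intro r
  rw [PowerSeries.coeff_one]
  split_ifs with h
  · simp [h]
  · simpa using pow_nonneg hB r

/-- The constants multiply while B stays the same: by the ultrametric inequality the number of terms
in a coefficient does not enter. For a product of linear factors, degree r thus costs only B ^ r
over the product of the constant terms. -/
theorem prod (hw : IsNonarchimedean w) (hB : 0 ≤ B) {ι : Type*} {s : Finset ι} {c : ι → ℝ}
    {u : ι → PowerSeries K} (h : ∀ i ∈ s, CoeffBound w (c i) B (u i)) :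
    CoeffBound w (∏ i ∈ s, c i) B (∏ i ∈ s, u i) := by
  classical
  induction s using Finset.induction_on with
  | empty => simpa using one hB
  | insert a s ha ih =>
    rw [Finset.prod_insert ha, Finset.prod_insert ha]
    exact (h a (Finset.mem_insert_self a s)).mul hw hB
      (ih fun i hi => h i (Finset.mem_insert_of_mem hi))

theorem linear {a : K} (ha : a ≠ 0) (hB : (w a)⁻¹ ≤ B) :
    CoeffBound w (w a) B (PowerSeries.C a + PowerSeries.X) := by
  have ha' : 0 < w a := w.pos ha
  have hB0 : 0 ≤ B := (inv_nonneg.2 ha'.le).trans hB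
  intro r
  rcases r with _ | _ | r
  · simp
  · rw [inv_le_iff_one_le_mul₀ ha'] at hB
    simpa [mul_comm] using hB
  · rw [map_add, PowerSeries.coeff_C, PowerSeries.coeff_X]
    simp only [Nat.add_eq_zero_iff, one_ne_zero, and_false, if_false, Nat.add_eq_right,
      add_zero, map_zero]
    positivity

theorem coeff_inv_linear {K : Type*} [Field K] {a : K} (ha : a ≠ 0) (r : ℕ) :
    PowerSeries.coeff r (PowerSeries.C a + PowerSeries.X)⁻¹ = (-1) ^ r / a ^ (r + 1) := by
  have h : (PowerSeries.C a + PowerSeries.X)⁻¹ =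
      PowerSeries.mk fun r => (-1) ^ r / a ^ (r + 1) := by
    rw [eq_comm, PowerSeries.eq_inv_iff_mul_eq_one (by simpa using ha)]
    ext n
    rw [mul_add, map_add, mul_comm, PowerSeries.coeff_C_mul, PowerSeries.coeff_mk]
    rcases n with _ | n
    · simp [ha]
    · rw [PowerSeries.coeff_succ_mul_X, PowerSeries.coeff_mk, PowerSeries.coeff_one,
        if_neg n.succ_ne_zero]
      field_simp
      ring
  rw [h, PowerSeries.coeff_mk]

theorem inv_linear {a : K} (ha : a ≠ 0) (hB : (w a)⁻¹ ≤ B) :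
    CoeffBound w (w a)⁻¹ B (PowerSeries.C a + PowerSeries.X)⁻¹ := by
  have ha' : 0 < w a := w.pos ha
  intro r
  rw [coeff_inv_linear ha, map_div₀, map_pow, map_pow, w.map_neg, map_one, one_pow, one_div,
    pow_succ, mul_inv, mul_comm, ← inv_pow]
  gcongr

end CoeffBound

end CoeffBound

/-! ### Jets of rising and falling factorials -/

section Jets

/-- The Taylor expansion at `γ` of `s ↦ Γ(s + n + 1) / Γ(s) = s (s + 1) ⋯ (s + n)`. -/
def ascJet {K : Type*} [Field K] (γ : K) (n : ℕ) : PowerSeries K :=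
  ∏ m ∈ Finset.range (n + 1), (PowerSeries.C (γ + m) + PowerSeries.X)

/-- The Taylor expansion at `γ` of `s ↦ Γ(s - n + 1) / Γ(s) = s / (s (s - 1) ⋯ (s - n + 1))`. -/
def descJet {K : Type*} [Field K] (γ : K) (n : ℕ) : PowerSeries K :=
  (PowerSeries.C γ + PowerSeries.X) *
    ∏ m ∈ Finset.range n, (PowerSeries.C (γ - m) + PowerSeries.X)⁻¹

theorem constantCoeff_ascJet {K : Type*} [Field K] (γ : K) (n : ℕ) :
    PowerSeries.constantCoeff (ascJet γ n) = ∏ m ∈ Finset.range (n + 1), (γ + m) := by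
  simp [ascJet, map_prod]

theorem constantCoeff_descJet {K : Type*} [Field K] (γ : K) (n : ℕ) :
    PowerSeries.constantCoeff (descJet γ n) = γ * ∏ m ∈ Finset.range n, (γ - m)⁻¹ := by
  simp [descJet, map_prod]

theorem add_natCast_ne_zero {K : Type*} [Field K] {γ : K} (hγ : ∀ n : ℤ, γ ≠ n) (m : ℕ) : γ + m ≠ 0 := fun h =>
  hγ (-m) (by push_cast; linear_combination h)

theorem sub_natCast_ne_zero {K : Type*} [Field K] {γ : K} (hγ : ∀ n : ℤ, γ ≠ n) (m : ℕ) : γ - m ≠ 0 := fun h =>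
  hγ m (by push_cast; linear_combination h)

variable {K : Type*} [Field K] [NumberField K] (v : NumberField.FinitePlace K)

/-- The coefficients of the power series `u n` grow at most like `ρ ^ n`, and the constant
coefficients grow exactly like `ρ ^ n`, up to polynomials in `n`. -/
structure JetGrowth (ρ : ℝ) (u : ℕ → PowerSeries K) : Prop where
  upper : ∀ r, PolyGrowth id fun n => absV v (PowerSeries.coeff r (u n)) * ρ⁻¹ ^ n
  lower : PolyGrowth id fun n => (absV v (PowerSeries.constantCoeff (u n)))⁻¹ * ρ ^ n
  ne_zero : ∀ n, PowerSeries.constantCoeff (u n) ≠ 0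

variable {v} {γ : K}

/-- One polynomial bound serves all shifts of size less than n in both directions. The condition 1 ≤
B n lets (B n)⁻¹ be the constant c of `factorial_mul_le_prod_shift`. -/
theorem exists_inv_absV_shift_bound (hγ : ∀ n : ℤ, γ ≠ n) :
    ∃ B : ℕ → ℝ, PolyGrowth id B ∧ (∀ n, 1 ≤ B n) ∧
      (∀ n m : ℕ, m < n → (absV v (γ + m))⁻¹ ≤ B n) ∧
      ∀ n m : ℕ, m < n → (absV v (γ - m))⁻¹ ≤ B n := by
  obtain ⟨C, hC, D, h⟩ := polyGrowth_inv_absV_add_intCast v hγ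
  have hmon : ∀ n m : ℕ, m < n → C * ((m : ℝ) + 1) ^ D ≤ max C 1 * ((n : ℝ) + 1) ^ D := by
    intro n m hm
    have : (m : ℝ) ≤ n := by exact_mod_cast hm.le
    exact mul_le_mul (le_max_left _ _) (by gcongr) (by positivity) (by positivity)
  refine ⟨fun n => max C 1 * ((n : ℝ) + 1) ^ D, ⟨max C 1, by positivity, D, fun n => le_rfl⟩,
    fun n => ?_, fun n m hm => ?_, fun n m hm => ?_⟩
  · exact one_le_mul_of_one_le_of_one_le (le_max_right _ _) (one_le_pow₀ (by simp))
  · refine le_trans ?_ (hmon n m hm)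
    simpa using h m
  · refine le_trans ?_ (hmon n m hm)
    simpa [sub_eq_add_neg] using h (-m)

theorem polyGrowth_prod_shift (hγp : γ ∈ padicIntegers v) :
    PolyGrowth id fun n : ℕ => (∏ m ∈ Finset.range n, absV v (γ + m)) * (piV v)⁻¹ ^ n := by
  refine ((PolyGrowth.const id (residuePrime v : ℝ)).mul (PolyGrowth.size_add_one id)
    fun n => by positivity).mono fun n => ?_
  have hπ := pow_pos (piV_pos v) n
  rw [inv_pow, ← div_eq_mul_inv, div_le_iff₀ hπ, mul_comm _ (piV v ^ n)]
  exact (prod_shift_le_factorial (isNonarchimedean_placeAbs v) hγp n).trans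
    (absV_factorial_le v n)

theorem polyGrowth_inv_prod_shift (hγ : ∀ n : ℤ, γ ≠ n) :
    PolyGrowth id fun n : ℕ => (∏ m ∈ Finset.range n, absV v (γ + m))⁻¹ * piV v ^ n := by
  obtain ⟨B, hB, hB1, hBγ, -⟩ := exists_inv_absV_shift_bound (v := v) hγ
  refine hB.mono fun n => ?_
  have hpos : ∀ m : ℕ, 0 < absV v (γ + m) := fun m => (placeAbs v).pos fun h =>
    hγ (-m) (by push_cast; linear_combination h)
  have hB0 : 0 < B n := one_pos.trans_le (hB1 n)
  have h := factorial_mul_le_prod_shift (isNonarchimedean_placeAbs v) (γ := γ) (n := n)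
    (inv_nonneg.2 hB0.le) (inv_le_one_of_one_le₀ (hB1 n))
    fun m hm => inv_le_of_inv_le₀ (hpos m) (hBγ n m hm)
  rw [inv_mul_le_iff₀ (Finset.prod_pos fun m _ => hpos m), mul_comm]
  rw [inv_mul_le_iff₀ hB0] at h
  exact (piV_pow_le_absV_factorial v n).trans h

theorem neg_mem_padicIntegers (hγp : γ ∈ padicIntegers v) : -γ ∈ padicIntegers v := by
  intro ε hε
  obtain ⟨n, hn⟩ := hγp ε hε
  refine ⟨-n, ?_⟩
  rw [← placeAbs_apply, show -γ - ((-n : ℤ) : K) = -(γ - n) by push_cast; ring, (placeAbs v).map_neg]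
  exact hn

/-- Falling shifts of γ are rising shifts of -γ up to sign, so the bounds on rising products also
serve `descJet`. -/
theorem absV_sub_natCast (m : ℕ) : absV v (γ - m) = absV v (-γ + m) := by
  rw [← placeAbs_apply, ← (placeAbs v).map_neg, placeAbs_apply]
  congr 1
  ring

theorem jetGrowth_ascJet (hγp : γ ∈ padicIntegers v) (hγ : ∀ n : ℤ, γ ≠ n) :
    JetGrowth v (piV v) (ascJet γ) := by
  have hπ := piV_pos v
  have hw := isNonarchimedean_placeAbs v
  obtain ⟨B, hB, hB1, hBγ, -⟩ := exists_inv_absV_shift_bound (v := v) hγ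
  have hB0 : ∀ n, 0 ≤ B n := fun n => zero_le_one.trans (hB1 n)
  refine ⟨fun r => ?_, ?_, fun n => ?_⟩
  · refine (((polyGrowth_prod_shift hγp).mul (hB.pow hB0 r) fun n =>
      pow_nonneg (hB0 n) r).of_succ.mul (PolyGrowth.const id (piV v)) fun _ => hπ.le).mono
      fun n => ?_
    have h : CoeffBound (placeAbs v) _ (B (n + 1)) (ascJet γ n) :=
      CoeffBound.prod hw (hB0 _) fun m hm => CoeffBound.linear (add_natCast_ne_zero hγ m)
        (hBγ _ m (Finset.mem_range.1 hm))
    calc _ ≤ _ := mul_le_mul_of_nonneg_right (h r) (by positivity)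
      _ = _ := by
        rw [pow_succ]
        simp only [placeAbs_apply]
        field_simp
  · refine ((polyGrowth_inv_prod_shift (v := v) hγ).of_succ.mul (PolyGrowth.const id (piV v)⁻¹)
      fun _ => by positivity).mono fun n => le_of_eq ?_
    rw [constantCoeff_ascJet, ← placeAbs_apply, map_prod, pow_succ]
    simp only [placeAbs_apply]
    field_simp
  · rw [constantCoeff_ascJet]
    exact Finset.prod_ne_zero_iff.2 fun m _ => add_natCast_ne_zero hγ m

/-- The shifts stand in the denominator, so the two bounds on products exchange roles: the Liouville
bound gives `upper` and the integrality of -γ gives `lower`. -/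
theorem jetGrowth_descJet (hγp : γ ∈ padicIntegers v) (hγ : ∀ n : ℤ, γ ≠ n) :
    JetGrowth v (piV v)⁻¹ (descJet γ) := by
  have hπ := piV_pos v
  have hw := isNonarchimedean_placeAbs v
  obtain ⟨B, hB, hB1, -, hBγ⟩ := exists_inv_absV_shift_bound (v := v) hγ
  have hB0 : ∀ n, 0 ≤ B n := fun n => zero_le_one.trans (hB1 n)
  have hγ' : ∀ n : ℤ, -γ ≠ n := fun n h => hγ (-n) (by push_cast; rw [← h, neg_neg])
  have h0 : γ ≠ 0 := by simpa using hγ 0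
  have hγ0 : 0 ≤ absV v γ := (placeAbs v).nonneg γ
  refine ⟨fun r => ?_, ?_, fun n => ?_⟩
  · refine (((polyGrowth_inv_prod_shift (v := v) hγ').mul (hB.of_succ.pow (fun n => hB0 _) r) fun n =>
      pow_nonneg (hB0 _) r).mul (PolyGrowth.const id (absV v γ)) fun _ => hγ0).mono fun n => ?_
    -- The bound at n + 1 rather than n also covers the factor γ + T when n = 0.
    have h : CoeffBound (placeAbs v) _ (B (n + 1)) (descJet γ n) :=
      (CoeffBound.linear h0 (by simpa [placeAbs_apply] using hBγ (n + 1) 0 n.succ_pos)).mul hw (hB0 _)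
        (CoeffBound.prod hw (hB0 _) fun m hm => CoeffBound.inv_linear (sub_natCast_ne_zero hγ m)
          (hBγ _ m ((Finset.mem_range.1 hm).trans n.lt_succ_self)))
    rw [inv_inv]
    calc _ ≤ _ := mul_le_mul_of_nonneg_right (h r) (by positivity)
      _ = _ := by
        simp only [placeAbs_apply, absV_sub_natCast, Finset.prod_inv_distrib]
        ring
  · refine ((polyGrowth_prod_shift (neg_mem_padicIntegers hγp)).mul
      (PolyGrowth.const id (absV v γ)⁻¹) fun _ => inv_nonneg.2 hγ0).mono fun n => le_of_eq ?_
    rw [constantCoeff_descJet, ← placeAbs_apply, map_mul, map_prod]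
    simp only [map_inv₀, placeAbs_apply, absV_sub_natCast, Finset.prod_inv_distrib, mul_inv,
      inv_inv]
    ring
  · rw [constantCoeff_descJet]
    exact mul_ne_zero h0 (Finset.prod_ne_zero_iff.2 fun m _ => inv_ne_zero (sub_natCast_ne_zero hγ m))

end Jets

/-! ### Taylor expansions of the Gamma function -/

section GammaJet

/-- The Taylor expansion of the Gamma function at `s`. -/
def gammaJet (s : ℂ) : PowerSeries ℂ :=
  PowerSeries.mk fun r => iteratedDeriv r Complex.Gamma s / r.factorial

/-- The function 1/Γ is entire; it is inverted where it does not vanish. -/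
theorem contDiffAt_Gamma {s : ℂ} (hs : ∀ m : ℕ, s ≠ -m) {n : WithTop ℕ∞} :
    ContDiffAt ℂ n Complex.Gamma s := by
  have h : ContDiffAt ℂ n (fun z => (Complex.Gamma z)⁻¹) s :=
    Complex.differentiable_one_div_Gamma.contDiff.contDiffAt
  exact (h.inv (inv_ne_zero (Complex.Gamma_ne_zero hs))).congr_of_eventuallyEq
    (Eventually.of_forall fun z => (inv_inv (Complex.Gamma z)).symm)

theorem iteratedDeriv_id_mul_Gamma {s : ℂ} (hs : ∀ m : ℕ, s ≠ -m) (r : ℕ) :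
    iteratedDeriv (r + 1) (fun z => z * Complex.Gamma z) s =
      s * iteratedDeriv (r + 1) Complex.Gamma s + (r + 1) * iteratedDeriv r Complex.Gamma s := by
  rw [iteratedDeriv_fun_mul contDiffAt_fun_id (contDiffAt_Gamma hs), Finset.sum_range_succ',
    Finset.sum_range_succ', Finset.sum_eq_zero]
  · simp only [Nat.choose_zero_right, iteratedDeriv_fun_id]
    simp [add_comm]
  · intro i _
    simp [iteratedDeriv_fun_id]

/-- This is Γ(z + 1) = z Γ(z) near s, with z = s + T. The equation is used as an identity of germs,
since it is only invoked for z ≠ 0. -/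
theorem gammaJet_add_one {s : ℂ} (hs : ∀ m : ℕ, s ≠ -m) :
    gammaJet (s + 1) = (PowerSeries.C s + PowerSeries.X) * gammaJet s := by
  have h0 : s ≠ 0 := by simpa using hs 0
  have hderiv : ∀ r, iteratedDeriv r Complex.Gamma (s + 1) =
      iteratedDeriv r (fun z => z * Complex.Gamma z) s := fun r => by
    have h1 := congrFun (iteratedDeriv_comp_add_const (n := r) (f := Complex.Gamma) (s := 1)) s
    rw [← h1]
    refine Filter.EventuallyEq.iteratedDeriv_eq r ?_
    filter_upwards [isOpen_ne.mem_nhds h0] with z hz using Complex.Gamma_add_one z hz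
  ext r
  rw [gammaJet, PowerSeries.coeff_mk, hderiv, add_mul, map_add, PowerSeries.coeff_C_mul]
  rcases r with _ | r
  · simp [gammaJet]
  · rw [PowerSeries.coeff_succ_X_mul, iteratedDeriv_id_mul_Gamma hs, gammaJet,
      PowerSeries.coeff_mk, PowerSeries.coeff_mk, Nat.factorial_succ]
    have h1 : (r.factorial : ℂ) ≠ 0 := by exact_mod_cast r.factorial_ne_zero
    have h2 : (r : ℂ) + 1 ≠ 0 := by exact_mod_cast r.succ_ne_zero
    push_cast
    field_simp

theorem add_intCast_ne {E : Type*} [Ring E] {s : E} (hs : ∀ n : ℤ, s ≠ n) (m : ℤ) :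
    ∀ n : ℤ, s + m ≠ n := fun n h =>
  hs (n - m) (by rw [Int.cast_sub, ← h, add_sub_cancel_right])

theorem ne_neg_natCast {s : ℂ} (hs : ∀ n : ℤ, s ≠ n) (m : ℕ) : s ≠ -m := by
  simpa using hs (-m)

theorem gammaJet_add_natCast {s : ℂ} (hs : ∀ n : ℤ, s ≠ n) (n : ℕ) :
    gammaJet (s + n + 1) = ascJet s n * gammaJet s := by
  have h1 : ∀ n : ℕ, gammaJet (s + n + 1) =
      (PowerSeries.C (s + n) + PowerSeries.X) * gammaJet (s + n) := fun n =>
    gammaJet_add_one (ne_neg_natCast (by simpa using add_intCast_ne hs n))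
  induction n with
  | zero =>
    have := h1 0
    simpa [ascJet] using this
  | succ n ih =>
    rw [h1, ascJet, Finset.prod_range_succ]
    push_cast at ih ⊢
    rw [← add_assoc, ih, ascJet]
    ring

theorem isUnit_linear {E : Type*} [Field E] {a : E} (ha : a ≠ 0) :
    (PowerSeries.C a + PowerSeries.X) * (PowerSeries.C a + PowerSeries.X)⁻¹ = 1 :=
  PowerSeries.mul_inv_cancel _ (by simpa using ha)

theorem gammaJet_sub_natCast {s : ℂ} (hs : ∀ n : ℤ, s ≠ n) (n : ℕ) :
    gammaJet (s - n + 1) = descJet s n * gammaJet s := by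
  induction n with
  | zero =>
    simpa [descJet] using gammaJet_add_one (ne_neg_natCast hs)
  | succ n ih =>
    have h1 : gammaJet (s - n + 1) =
        (PowerSeries.C (s - n) + PowerSeries.X) * gammaJet (s - n) :=
      gammaJet_add_one (ne_neg_natCast (by simpa [sub_eq_add_neg] using add_intCast_ne hs (-n)))
    have h2 := isUnit_linear (sub_natCast_ne_zero hs n)
    have h3 : descJet s (n + 1) =
        descJet s n * (PowerSeries.C (s - n) + PowerSeries.X)⁻¹ := by
      rw [descJet, descJet, Finset.prod_range_succ, mul_assoc]
    rw [h3, mul_right_comm, ← ih, h1, mul_right_comm, h2, one_mul]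
    congr 1
    push_cast
    ring

end GammaJet

/-! ### Partial fractions -/

section PartialFractions

/-- These products are the denominators of the Lagrange basis at equally spaced nodes: the indices
below m give (-1)^m m!, those above give (n - m)!. -/
theorem prod_erase_range_sub {E : Type*} [Field E] {m n : ℕ} (hm : m ≤ n) :
    ∏ j ∈ (Finset.range (n + 1)).erase m, ((j : E) - m) =
      (-1) ^ m * m.factorial * (n - m).factorial := by
  obtain ⟨t, rfl⟩ := Nat.exists_eq_add_of_le hm
  have h : ∏ j ∈ (Finset.range (m + t + 1)).erase m, ((j : E) - m) =
      ∏ j ∈ Finset.range (m + (t + 1)), if j = m then 1 else (j : E) - m := by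
    rw [← Finset.prod_erase (Finset.range (m + (t + 1))) (a := m) (by simp)]
    refine Finset.prod_congr rfl fun j hj => ?_
    rw [if_neg (Finset.ne_of_mem_erase hj)]
  rw [h, Finset.prod_range_add, Finset.prod_range_succ']
  have h1 : (∏ j ∈ Finset.range m, if j = m then 1 else (j : E) - m) = (-1) ^ m * m.factorial := by
    rw [← Finset.prod_range_add_one_eq_factorial, ← Finset.prod_range_reflect, Nat.cast_prod]
    have : (-1 : E) ^ m = ∏ _j ∈ Finset.range m, (-1) := by simp
    rw [this, ← Finset.prod_mul_distrib]
    refine Finset.prod_congr rfl fun j hj => ?_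
    have hj' := Finset.mem_range.1 hj
    rw [if_neg (by omega), Nat.cast_sub (by omega), Nat.cast_sub (by omega)]
    push_cast
    ring
  have h2 : (∏ j ∈ Finset.range t, if m + (j + 1) = m then 1 else ((m + (j + 1) : ℕ) : E) - m) =
      t.factorial := by
    rw [← Finset.prod_range_add_one_eq_factorial, Nat.cast_prod]
    refine Finset.prod_congr rfl fun j _ => ?_
    rw [if_neg (by omega)]
    push_cast
    ring
  rw [h1, h2]
  simp [mul_assoc]

/-- Partial fractions for `1 / (a (a + 1) ⋯ (a + n))`. -/
theorem sum_partial_fractions_mul_ascJet {E : Type*} [Field E] [CharZero E] {a : E}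
    (ha : ∀ n : ℤ, a ≠ n) (n : ℕ) :
    (∑ m ∈ Finset.range (n + 1), PowerSeries.C ((-1) ^ m / ((m.factorial : E) * (n - m).factorial)) *
      (PowerSeries.C (a + m) + PowerSeries.X)⁻¹) * ascJet a n = 1 := by
  have hinj : Set.InjOn (fun m : ℕ => -(a + m)) (Finset.range (n + 1)) := by
    intro i _ j _ hij
    simpa using hij
  -- The Lagrange basis at the nodes -(a + m) sums to 1, and its m-th member is a constant times
  -- `ascJet a n` without the factor a + m + T.
  have hL := congrArg (Polynomial.coeToPowerSeries.ringHom (R := E))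
    (Lagrange.sum_basis hinj ⟨0, by simp⟩)
  rw [map_sum, map_one] at hL
  rw [← hL, Finset.sum_mul]
  refine Finset.sum_congr rfl fun m hm => ?_
  have hmn : m ≤ n := Nat.lt_succ_iff.1 (Finset.mem_range.1 hm)
  have hb : ∀ j : ℕ, Polynomial.coeToPowerSeries.ringHom
      (Lagrange.basisDivisor (-(a + m)) (-(a + j))) =
      PowerSeries.C ((j : E) - m)⁻¹ * (PowerSeries.C (a + j) + PowerSeries.X) := fun j => by
    rw [Lagrange.basisDivisor, map_mul, Polynomial.coeToPowerSeries.ringHom_apply,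
      Polynomial.coeToPowerSeries.ringHom_apply, Polynomial.coe_C, Polynomial.coe_sub,
      Polynomial.coe_X, Polynomial.coe_C, map_neg, sub_neg_eq_add, sub_neg_eq_add,
      add_comm PowerSeries.X]
    congr 3
    ring
  have hc : ((-1 : E) ^ m * m.factorial * (n - m).factorial)⁻¹ =
      (-1) ^ m / (m.factorial * (n - m).factorial) := by
    rw [mul_assoc, mul_inv, ← inv_pow, inv_neg_one, div_eq_mul_inv]
  rw [Lagrange.basis, map_prod, Finset.prod_congr rfl fun j _ => hb j, Finset.prod_mul_distrib,
    ← map_prod, Finset.prod_inv_distrib, prod_erase_range_sub hmn, hc, ascJet,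
    ← Finset.mul_prod_erase _ _ hm, mul_assoc]
  congr 1
  rw [← mul_assoc, mul_comm _⁻¹, isUnit_linear (add_natCast_ne_zero ha m), one_mul]

end PartialFractions

/-! ### The transform of a monomial -/

section LaplacePoly

theorem coeff_classicalPoly (γ : ℂ) (k i : ℕ) :
    (classicalPoly γ k).coeff i = if i ≤ k then
      (k.factorial : ℂ) / i.factorial * (-1) ^ i * PowerSeries.coeff (k - i) (gammaJet (γ + 1))
      else 0 := by
  rw [classicalPoly, Polynomial.finsetSum_coeff]
  simp only [Polynomial.coeff_monomial]
  split_ifs with hi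
  · rw [Finset.sum_eq_single (k - i)]
    · rw [if_pos (by omega), show k - (k - i) = i by omega, gammaJet, PowerSeries.coeff_mk,
        Nat.choose_symm hi, Nat.cast_choose ℂ hi]
      field_simp
    · intro j hj hji
      have := Finset.mem_range.1 hj
      rw [if_neg (by omega)]
    · intro h
      exact absurd (Finset.mem_range.2 (by omega)) h
  · refine Finset.sum_eq_zero fun j _ => if_neg (by omega)

/-- The logarithmic terms of the iterated primitive are derivatives in γ of its coefficient for x^γ,
so they are read off a power series in T = s - γ. -/
theorem primitiveCoeff_eq {γ : ℂ} (hγ : ∀ n : ℤ, γ ≠ n) (k n ℓ : ℕ) :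
    primitiveCoeff γ k n ℓ = (k.factorial : ℂ) / ℓ.factorial * PowerSeries.coeff (k - ℓ)
      (∑ m ∈ Finset.range (n + 1),
        PowerSeries.C ((-1) ^ m / ((m.factorial : ℂ) * (n - m).factorial)) *
          (PowerSeries.C (γ + 1 + m) + PowerSeries.X)⁻¹) := by
  have h1 : ∀ n : ℤ, γ + 1 ≠ n := by simpa using add_intCast_ne hγ 1
  rw [primitiveCoeff, map_sum, Finset.mul_sum]
  refine Finset.sum_congr rfl fun m _ => ?_
  have h2 := add_natCast_ne_zero h1 m
  rw [PowerSeries.coeff_C_mul, CoeffBound.coeff_inv_linear h2,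
    show (m : ℂ) + γ + 1 = γ + 1 + m by ring]
  field_simp
  ring

/-- The coefficients of the polynomial `Λ` with `𝓛(x^γ (log x)^k) = x^(-γ-1) Λ(log x)`. -/
theorem coeff_laplacePoly {γ : ℂ} (hγ : ∀ n : ℤ, γ ≠ n) (k i : ℕ) :
    (laplacePoly γ k).coeff i = if i ≤ k then
      (k.factorial : ℂ) / i.factorial * (-1) ^ i * PowerSeries.coeff (k - i) (gammaJet (γ + 1))
      else 0 := by
  rw [laplacePoly]
  by_cases hre : -1 < γ.re
  · rw [if_pos hre, coeff_classicalPoly]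
  rw [if_neg hre]
  simp only [Polynomial.finsetSum_coeff, Polynomial.coeff_smul, coeff_classicalPoly, smul_eq_mul]
  have h1 : ∀ n : ℤ, γ + 1 ≠ n := by simpa using add_intCast_ne hγ 1
  -- The computation holds for every n, so the transform does not depend on the number of
  -- primitives.
  generalize ⌈-γ.re - 1⌉₊ + 1 = n
  split_ifs with hi
  · have hQ := sum_partial_fractions_mul_ascJet h1 n
    have hG := gammaJet_add_natCast h1 n
    have hP := primitiveCoeff_eq hγ k n
    generalize (∑ m ∈ Finset.range (n + 1),
      PowerSeries.C ((-1) ^ m / ((m.factorial : ℂ) * (n - m).factorial)) *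
        (PowerSeries.C (γ + 1 + m) + PowerSeries.X)⁻¹) = Q at hQ hP
    -- By partial fractions Q inverts the jet by which the Gamma expansion at γ + n + 2 exceeds that
    -- at γ + 1.
    have hQG : Q * gammaJet (γ + n + 1 + 1) = gammaJet (γ + 1) := by
      rw [show γ + n + 1 + 1 = γ + 1 + n + 1 by ring, hG, ← mul_assoc, hQ, one_mul]
    rw [← hQG, PowerSeries.coeff_mul, Finset.Nat.sum_antidiagonal_eq_sum_range_succ
      (fun a b => PowerSeries.coeff a Q * PowerSeries.coeff b (gammaJet (γ + n + 1 + 1))),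
      ← Finset.sum_range_reflect, Finset.mul_sum]
    symm
    -- After the reflection ℓ = k - a; terms with a > k - i have ℓ < i and vanish.
    refine Finset.sum_subset_zero_on_sdiff
      (Finset.range_subset_range.2 (by omega)) (fun a ha => ?_) fun a ha => ?_
    · simp only [Finset.mem_sdiff, Finset.mem_range] at ha
      rw [if_neg (by omega), mul_zero]
    · have ha' := Finset.mem_range.1 ha
      rw [if_pos (by omega), hP, show k - (k + 1 - 1 - a) = a by omega,
        show k + 1 - 1 - a - i = k - i - a by omega]
      have h2 : ((k + 1 - 1 - a).factorial : ℂ) ≠ 0 := by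
        exact_mod_cast Nat.factorial_ne_zero _
      field_simp
  · refine Finset.sum_eq_zero fun ℓ hℓ => ?_
    have := Finset.mem_range.1 hℓ
    rw [if_neg (by omega), mul_zero]

end LaplacePoly

/-! ### The transform of a polynomial in logarithms -/

section LaplaceOp

/-- In the generating function e^(-TX) Γ(γ + 1 + T), differentiating in X multiplies by -T. For k =
0 the truncated k - 1 is harmless, as its factor is 0. -/
theorem derivative_laplacePoly {γ : ℂ} (hγ : ∀ n : ℤ, γ ≠ n) (k : ℕ) :
    Polynomial.derivative (laplacePoly γ k) = -((k : ℂ) • laplacePoly γ (k - 1)) := by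
  ext i
  rw [Polynomial.coeff_derivative, Polynomial.coeff_neg, Polynomial.coeff_smul,
    coeff_laplacePoly hγ, coeff_laplacePoly hγ, smul_eq_mul]
  rcases k with _ | k
  · simp
  rw [Nat.add_sub_cancel]
  by_cases hi : i ≤ k
  · rw [if_pos hi, if_pos (by omega), show k + 1 - (i + 1) = k - i by omega, Nat.factorial_succ,
      Nat.factorial_succ]
    have h2 : (i : ℂ) + 1 ≠ 0 := by exact_mod_cast i.succ_ne_zero
    push_cast
    field_simp
    ring
  · rw [if_neg hi, if_neg (by omega)]
    simp

/-- Raising γ by 1 multiplies the generating function by γ + 1 + T. -/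
theorem laplacePoly_add_one {γ : ℂ} (hγ : ∀ n : ℤ, γ ≠ n) (k : ℕ) :
    laplacePoly (γ + 1) k = (γ + 1) • laplacePoly γ k + (k : ℂ) • laplacePoly γ (k - 1) := by
  have h1 : ∀ n : ℤ, γ + 1 ≠ n := by simpa using add_intCast_ne hγ 1
  ext i
  simp only [Polynomial.coeff_add, Polynomial.coeff_smul, coeff_laplacePoly hγ,
    coeff_laplacePoly h1, smul_eq_mul]
  rw [gammaJet_add_one (ne_neg_natCast h1), add_mul, map_add, PowerSeries.coeff_C_mul]
  by_cases hi : i ≤ k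
  · rw [if_pos hi, if_pos hi]
    rcases Nat.exists_eq_add_of_le hi with ⟨t, rfl⟩
    rw [Nat.add_sub_cancel_left]
    rcases t with _ | t
    · rcases i with _ | i
      · simp
      · simp
        ring
    · rw [PowerSeries.coeff_succ_X_mul, if_pos (by omega),
        show i + (t + 1) - 1 - i = t by omega, show i + (t + 1) - 1 = i + t by omega,
        ← add_assoc i t 1, Nat.factorial_succ]
      push_cast
      ring
  · rw [if_neg hi, if_neg hi, if_neg (by omega)]
    simp

variable {d : ℕ}

/-- The polynomial `Λ` in `d` variables with `𝓛(x^δ (log x)^k) = x^(-δ-1) Λ(log x)`. -/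
def laplaceMonomial (δ : Fin d → ℂ) (k : Fin d →₀ ℕ) : MvPolynomial (Fin d) ℂ :=
  ∏ i, Polynomial.aeval (MvPolynomial.X i : MvPolynomial (Fin d) ℂ) (laplacePoly (δ i) (k i))

theorem laplaceMonomial_eq_mul (δ : Fin d → ℂ) (k : Fin d →₀ ℕ) (i : Fin d) :
    laplaceMonomial δ k =
      Polynomial.aeval (MvPolynomial.X i : MvPolynomial (Fin d) ℂ) (laplacePoly (δ i) (k i)) *
        ∏ j ∈ Finset.univ.erase i,
          Polynomial.aeval (MvPolynomial.X j : MvPolynomial (Fin d) ℂ) (laplacePoly (δ j) (k j)) :=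
  (Finset.mul_prod_erase _ _ (Finset.mem_univ i)).symm

theorem prod_erase_sub_single (δ : Fin d → ℂ) (k : Fin d →₀ ℕ) (i : Fin d) :
    ∏ j ∈ Finset.univ.erase i, Polynomial.aeval (MvPolynomial.X j : MvPolynomial (Fin d) ℂ)
      (laplacePoly (δ j) ((k - Finsupp.single i 1 : Fin d →₀ ℕ) j)) =
    ∏ j ∈ Finset.univ.erase i, Polynomial.aeval (MvPolynomial.X j : MvPolynomial (Fin d) ℂ)
      (laplacePoly (δ j) (k j)) := by
  refine Finset.prod_congr rfl fun j hj => ?_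
  rw [Finsupp.tsub_apply, Finsupp.single_eq_of_ne (Finset.ne_of_mem_erase hj), tsub_zero]

theorem pderiv_aeval_X (i j : Fin d) (p : Polynomial ℂ) :
    MvPolynomial.pderiv i (Polynomial.aeval (MvPolynomial.X j : MvPolynomial (Fin d) ℂ) p) =
      if j = i then Polynomial.aeval (MvPolynomial.X j) (Polynomial.derivative p) else 0 := by
  rw [Derivation.map_aeval, MvPolynomial.pderiv_X, Pi.single_apply]
  split_ifs <;> simp_all

theorem pderiv_laplaceMonomial {δ : Fin d → ℂ} {i : Fin d} (hδ : ∀ n : ℤ, δ i ≠ n)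
    (k : Fin d →₀ ℕ) :
    MvPolynomial.pderiv i (laplaceMonomial δ k) =
      -((k i : ℂ) • laplaceMonomial δ (k - Finsupp.single i 1)) := by
  have h0 : MvPolynomial.pderiv i (∏ j ∈ Finset.univ.erase i,
      Polynomial.aeval (MvPolynomial.X j : MvPolynomial (Fin d) ℂ) (laplacePoly (δ j) (k j))) = 0 := by
    refine MvPolynomial.pderiv_eq_zero_of_notMem_vars fun hi => ?_
    obtain ⟨j, hj, hij⟩ := Finset.mem_biUnion.1 (MvPolynomial.vars_prod _ hi)
    have hji := Finset.ne_of_mem_erase hj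
    rw [Polynomial.aeval_eq_sum_range] at hij
    obtain ⟨n, -, hn⟩ := Finset.mem_biUnion.1 (MvPolynomial.vars_sum_subset _ _ hij)
    rw [MvPolynomial.smul_eq_C_mul] at hn
    have h1 := MvPolynomial.vars_mul _ _ hn
    rw [MvPolynomial.vars_C, Finset.empty_union] at h1
    have h2 := MvPolynomial.vars_pow _ _ h1
    rw [MvPolynomial.vars_X, Finset.mem_singleton] at h2
    exact hji h2.symm
  rw [laplaceMonomial_eq_mul δ k i, Derivation.leibniz, h0, smul_zero, zero_add, pderiv_aeval_X,
    if_pos rfl, derivative_laplacePoly hδ, laplaceMonomial_eq_mul δ _ i, prod_erase_sub_single,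
    Finsupp.tsub_apply, Finsupp.single_eq_same, map_neg, map_smul, smul_eq_mul]
  rw [mul_neg, mul_smul_comm, mul_comm]

theorem laplaceMonomial_add_single {δ : Fin d → ℂ} {i : Fin d} (hδ : ∀ n : ℤ, δ i ≠ n)
    (k : Fin d →₀ ℕ) :
    laplaceMonomial (δ + Pi.single i 1) k =
      (δ i + 1) • laplaceMonomial δ k + (k i : ℂ) • laplaceMonomial δ (k - Finsupp.single i 1) := by
  have h : ∏ j ∈ Finset.univ.erase i, Polynomial.aeval (MvPolynomial.X j : MvPolynomial (Fin d) ℂ)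
      (laplacePoly ((δ + Pi.single i 1 : Fin d → ℂ) j) (k j)) =
      ∏ j ∈ Finset.univ.erase i, Polynomial.aeval (MvPolynomial.X j : MvPolynomial (Fin d) ℂ)
      (laplacePoly (δ j) (k j)) := by
    refine Finset.prod_congr rfl fun j hj => ?_
    rw [Pi.add_apply, Pi.single_eq_of_ne (Finset.ne_of_mem_erase hj), add_zero]
  rw [laplaceMonomial_eq_mul _ k i, h, Pi.add_apply, Pi.single_eq_same, laplacePoly_add_one hδ,
    laplaceMonomial_eq_mul δ k i, laplaceMonomial_eq_mul δ _ i, prod_erase_sub_single,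
    Finsupp.tsub_apply, Finsupp.single_eq_same, map_add, map_smul, map_smul, add_mul,
    smul_mul_assoc, smul_mul_assoc]

variable {K : Type*} [Field K] [Algebra K ℂ]

/-- The `K`-linear map `P ↦ Λ` with `𝓛(x^δ P(log x)) = x^(-δ-1) Λ(log x)`. -/
def laplaceOp (δ : Fin d → K) : MvPolynomial (Fin d) K →ₗ[K] MvPolynomial (Fin d) ℂ :=
  (MvPolynomial.basisMonomials (Fin d) K).constr K
    (laplaceMonomial fun i => algebraMap K ℂ (δ i))

theorem laplaceOp_monomial (δ : Fin d → K) (k : Fin d →₀ ℕ) (a : K) :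
    laplaceOp δ (MvPolynomial.monomial k a) =
      algebraMap K ℂ a • laplaceMonomial (fun i => algebraMap K ℂ (δ i)) k := by
  have h : MvPolynomial.monomial k a = a • MvPolynomial.basisMonomials (Fin d) K k := by
    rw [MvPolynomial.coe_basisMonomials, MvPolynomial.smul_monomial, smul_eq_mul, mul_one]
  rw [h, map_smul, laplaceOp, Module.Basis.constr_basis, algebraMap_smul]

theorem laplaceOp_eq_sum (δ : Fin d → K) (p : MvPolynomial (Fin d) K) :
    laplaceOp δ p = ∑ k ∈ p.support, algebraMap K ℂ (MvPolynomial.coeff k p) •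
      laplaceMonomial (fun i => algebraMap K ℂ (δ i)) k := by
  conv_lhs => rw [p.as_sum]
  rw [map_sum]
  exact Finset.sum_congr rfl fun k _ => laplaceOp_monomial δ k _

theorem pderiv_laplaceOp {δ : Fin d → K} {i : Fin d} (hδ : ∀ n : ℤ, δ i ≠ n)
    (p : MvPolynomial (Fin d) K) :
    MvPolynomial.pderiv i (laplaceOp δ p) = -laplaceOp δ (MvPolynomial.pderiv i p) := by
  have hδ' : ∀ n : ℤ, algebraMap K ℂ (δ i) ≠ n := fun n h =>
    hδ n ((algebraMap K ℂ).injective (by rw [h, map_intCast]))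
  induction p using MvPolynomial.induction_on' with
  | monomial k a =>
    rw [laplaceOp_monomial, MvPolynomial.pderiv_monomial, Derivation.map_smul,
      pderiv_laplaceMonomial hδ', laplaceOp_monomial, map_mul, map_natCast, mul_smul, smul_neg]
  | add p q hp hq => rw [map_add, map_add, map_add, map_add, hp, hq, neg_add]

/-- The argument on the right is the polynomial of ∂_i (x^(δ + e_i) P(log x)), so this is the
exchange of ∂_i and x_i at a single exponent. -/
theorem laplaceOp_add_single {δ : Fin d → K} {i : Fin d} (hδ : ∀ n : ℤ, δ i ≠ n)
    (p : MvPolynomial (Fin d) K) :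
    laplaceOp (δ + Pi.single i 1) p =
      laplaceOp δ ((δ i + 1) • p + MvPolynomial.pderiv i p) := by
  have hδ' : ∀ n : ℤ, algebraMap K ℂ (δ i) ≠ n := fun n h =>
    hδ n ((algebraMap K ℂ).injective (by rw [h, map_intCast]))
  have hs : (fun j => algebraMap K ℂ ((δ + Pi.single i 1 : Fin d → K) j)) =
      (fun j => algebraMap K ℂ (δ j)) + Pi.single i 1 := by
    funext j
    rw [Pi.add_apply, Pi.add_apply, map_add]
    congr 1
    simp only [Pi.single_apply]
    split_ifs <;> simp
  induction p using MvPolynomial.induction_on' with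
  | monomial k a =>
    rw [laplaceOp_monomial, hs, laplaceMonomial_add_single hδ', map_add, map_smul,
      laplaceOp_monomial, MvPolynomial.pderiv_monomial, laplaceOp_monomial, map_mul, map_natCast,
      mul_smul, smul_add, ← algebraMap_smul ℂ (δ i + 1), map_add, map_one, smul_comm]
  | add p q hp hq =>
    rw [map_add, hp, hq, ← map_add, smul_add, map_add (MvPolynomial.pderiv i)]
    congr 1
    abel

end LaplaceOp

/-! ### The transform and the Weyl algebra -/

section Weyl

theorem logSeries_ext {ι E : Type*} [CommRing E] {d : ℕ} {g h : LogSeries E d} {e : ι → Fin d → E}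
    (h1 : ∀ δ, g (e δ) = h (e δ)) (h2 : ∀ ε, (¬∃ δ, e δ = ε) → g ε = h ε) : g = h := by
  funext ε
  by_cases hε : ∃ δ, e δ = ε
  · obtain ⟨δ, rfl⟩ := hε
    exact h1 δ
  · exact h2 ε hε

section NonIntegral

variable {K : Type*} [Field K] {d : ℕ}

/-- All exponents of `g` have coordinates outside `ℤ`. -/
def NonIntegralSupport (g : LogSeries K d) : Prop :=
  ∀ δ : Fin d → K, ∀ i, ∀ n : ℤ, δ i = n → g δ = 0

theorem single_apply_eq_intCast {E : Type*} [Ring E] (i j : Fin d) :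
    ∃ n : ℤ, (Pi.single i (1 : E) : Fin d → E) j = n := by
  by_cases h : j = i
  · exact ⟨1, by simp [h]⟩
  · exact ⟨0, by simp [h]⟩

theorem NonIntegralSupport.mulX {g : LogSeries K d} (hg : NonIntegralSupport g) (i : Fin d) :
    NonIntegralSupport (mulX K i g) := fun δ j n h => by
  obtain ⟨m, hm⟩ := single_apply_eq_intCast (E := K) i j
  exact hg _ j (n - m) (by
    change δ j - (Pi.single i (1 : K) : Fin d → K) j = _
    rw [h, hm, Int.cast_sub])

theorem NonIntegralSupport.partialD {g : LogSeries K d} (hg : NonIntegralSupport g) (i : Fin d) :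
    NonIntegralSupport (partialD K i g) := fun δ j n h => by
  obtain ⟨m, hm⟩ := single_apply_eq_intCast (E := K) i j
  have h0 : g (δ + Pi.single i 1) = 0 :=
    hg _ j (n + m) (by rw [Pi.add_apply, h, hm, Int.cast_add])
  rw [partialD_apply, h0, smul_zero, map_zero, add_zero]

theorem weylMk_surjective : Function.Surjective (weylMk K (d := d)) :=
  RingQuot.mkAlgHom_surjective K (WeylRel K d)

theorem weylAction_wx {E : Type*} [CommRing E] [Algebra K E] (i : Fin d) :
    weylAction K (E := E) (wx K i) = mulX K i := by
  rw [weylAction, wx, weylLift_weylMk]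
  simp

theorem weylAction_wd {E : Type*} [CommRing E] [Algebra K E] (i : Fin d) :
    weylAction K (E := E) (wd K i) = partialD K i := by
  rw [weylAction, wd, weylLift_weylMk]
  simp

theorem nonIntegralSupport_mulH {γ : Fin d → K} (hγ : ∀ i, ∀ n : ℤ, γ i ≠ n)
    (f : MvPowerSeries (Fin d) K) (k : Fin d →₀ ℕ) : NonIntegralSupport (mulH f γ k) := by
  intro δ i n h
  refine Function.extend_apply' _ _ _ ?_
  rintro ⟨α, rfl⟩
  exact add_intCast_ne (hγ i) (α i) n (by simpa using h)

theorem nonIntegralSupport_mulHInv {γ : Fin d → K} (hγ : ∀ i, ∀ n : ℤ, γ i ≠ n)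
    (f : MvPowerSeries (Fin d) K) (k : Fin d →₀ ℕ) : NonIntegralSupport (mulHInv f γ k) := by
  intro δ i n h
  refine Function.extend_apply' _ _ _ ?_
  rintro ⟨α, rfl⟩
  exact add_intCast_ne (hγ i) (-α i) n (by simpa [sub_eq_add_neg] using h)

end NonIntegral

variable {K : Type*} [Field K] [Algebra K ℂ] {d : ℕ}

/-- The exponent `-δ-1` of the transform of a term with exponent `δ`. -/
def laplaceExponent (δ : Fin d → K) : Fin d → ℂ := fun i => -algebraMap K ℂ (δ i) - 1

theorem laplaceExponent_injective :
    Function.Injective (laplaceExponent : (Fin d → K) → Fin d → ℂ) := fun δ δ' h => by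
  funext i
  have := congrFun h i
  simpa [laplaceExponent] using this

theorem laplace_laplaceExponent (g : LogSeries K d) (δ : Fin d → K) :
    laplace g (laplaceExponent δ) = laplaceOp δ (g δ) := by
  rw [laplaceOp_eq_sum]
  exact laplaceExponent_injective.extend_apply _ _ _

theorem laplace_eq_zero (g : LogSeries K d) {ε : Fin d → ℂ}
    (hε : ¬∃ δ : Fin d → K, laplaceExponent δ = ε) : laplace g ε = 0 :=
  Function.extend_apply' _ _ _ hε

/-- The transform as a linear map. -/
def laplaceLin : LogSeries K d →ₗ[K] LogSeries ℂ d where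
  toFun := laplace
  map_add' g h := by
    refine logSeries_ext (e := laplaceExponent (K := K)) (fun δ => ?_) fun ε hε => ?_
    · simp only [Pi.add_apply, laplace_laplaceExponent, map_add]
    · simp only [Pi.add_apply, laplace_eq_zero _ hε, add_zero]
  map_smul' c g := by
    refine logSeries_ext (e := laplaceExponent (K := K)) (fun δ => ?_) fun ε hε => ?_
    · simp only [Pi.smul_apply, laplace_laplaceExponent, map_smul, RingHom.id_apply]
    · simp only [Pi.smul_apply, laplace_eq_zero _ hε, smul_zero]

theorem laplaceLin_apply (g : LogSeries K d) : laplaceLin g = laplace g := rfl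

theorem laplaceExponent_add_single (δ : Fin d → K) (i : Fin d) :
    laplaceExponent (δ + Pi.single i 1) = laplaceExponent δ - Pi.single i 1 := by
  funext j
  simp only [laplaceExponent, Pi.add_apply, Pi.sub_apply, Pi.single_apply, map_add]
  split_ifs <;> simp
  ring

theorem laplaceExponent_sub_single (δ : Fin d → K) (i : Fin d) :
    laplaceExponent (δ - Pi.single i 1) = laplaceExponent δ + Pi.single i 1 := by
  rw [eq_comm, ← eq_sub_iff_add_eq, ← laplaceExponent_add_single, sub_add_cancel]

theorem laplace_mulX {g : LogSeries K d} (hg : NonIntegralSupport g) (i : Fin d) :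
    laplace (mulX K i g) = -partialD K i (laplace g) := by
  refine logSeries_ext (e := laplaceExponent (K := K)) (fun δ => ?_) fun ε hε => ?_
  · obtain ⟨δ, rfl⟩ : ∃ δ', δ = δ' + Pi.single i 1 := ⟨δ - Pi.single i 1, by abel⟩
    rw [laplace_laplaceExponent, mulX_apply, add_sub_cancel_right, Pi.neg_apply, partialD_apply,
      laplaceExponent_add_single, sub_add_cancel, laplace_laplaceExponent]
    -- The recurrences need a nonintegral δ_i; at an integral one the coefficient of g is 0.
    by_cases hδ : ∃ n : ℤ, δ i = n
    · obtain ⟨n, hn⟩ := hδ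
      simp [hg δ i n hn]
    · push Not at hδ
      rw [laplaceOp_add_single hδ, pderiv_laplaceOp hδ, map_add, map_smul,
        ← algebraMap_smul ℂ (δ i + 1)]
      have : (laplaceExponent δ - Pi.single i 1 : Fin d → ℂ) i + 1 = -(algebraMap K ℂ (δ i + 1)) := by
        simp only [laplaceExponent, Pi.sub_apply, Pi.single_eq_same, map_add, map_one]
        ring
      rw [this, neg_smul]
      abel
  · rw [laplace_eq_zero _ hε, Pi.neg_apply, partialD_apply, laplace_eq_zero, smul_zero, map_zero,
      add_zero, neg_zero]
    rintro ⟨δ, hδ⟩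
    exact hε ⟨δ + Pi.single i 1, by rw [laplaceExponent_add_single, hδ, add_sub_cancel_right]⟩

theorem laplace_partialD {g : LogSeries K d} (hg : NonIntegralSupport g) (i : Fin d) :
    laplace (partialD K i g) = mulX K i (laplace g) := by
  refine logSeries_ext (e := laplaceExponent (K := K)) (fun δ => ?_) fun ε hε => ?_
  · rw [laplace_laplaceExponent, mulX_apply, ← laplaceExponent_add_single,
      laplace_laplaceExponent, partialD_apply]
    by_cases hδ : ∃ n : ℤ, δ i = n
    · obtain ⟨n, hn⟩ := hδ
      have : g (δ + Pi.single i 1) = 0 := hg _ i (n + 1) (by simp [hn])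
      simp [this]
    · push Not at hδ
      rw [laplaceOp_add_single hδ]
  · rw [laplace_eq_zero _ hε, mulX_apply, laplace_eq_zero]
    rintro ⟨δ, hδ⟩
    exact hε ⟨δ - Pi.single i 1, by rw [laplaceExponent_sub_single, hδ, sub_add_cancel]⟩

/-- The transform turns the action of `φ` into that of the Fourier-Laplace transform of `φ`. -/
theorem laplace_weylAction (φ : WeylAlgebra K d) :
    ∀ g : LogSeries K d, NonIntegralSupport g → NonIntegralSupport (weylAction K φ g) ∧
      laplace (weylAction K φ g) = weylAction K (fourierLaplace K φ) (laplace g) := by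
  obtain ⟨a, rfl⟩ := weylMk_surjective φ
  induction a using FreeAlgebra.induction with
  | grade0 c =>
    intro g hg
    rw [AlgHom.commutes, AlgHom.commutes, AlgHom.commutes, AlgHom.commutes,
      Module.algebraMap_end_apply, Module.algebraMap_end_apply, ← laplaceLin_apply,
      ← laplaceLin_apply, map_smul]
    exact ⟨fun δ i n h => by rw [Pi.smul_apply, hg δ i n h, smul_zero], rfl⟩
  | grade1 x =>
    intro g hg
    rcases x with i | i
    · change NonIntegralSupport (weylAction K (wx K i) g) ∧ laplace (weylAction K (wx K i) g) =
        weylAction K (fourierLaplace K (wx K i)) (laplace g)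
      rw [fourierLaplace_wx, map_neg, weylAction_wx, weylAction_wd, LinearMap.neg_apply]
      exact ⟨hg.mulX i, laplace_mulX hg i⟩
    · change NonIntegralSupport (weylAction K (wd K i) g) ∧ laplace (weylAction K (wd K i) g) =
        weylAction K (fourierLaplace K (wd K i)) (laplace g)
      rw [fourierLaplace_wd, weylAction_wx, weylAction_wd]
      exact ⟨hg.partialD i, laplace_partialD hg i⟩
  -- The hypothesis for a is applied to the image of g under b, so stability of the support must be
  -- part of the induction.
  | mul a b iha ihb =>
    intro g hg
    obtain ⟨hb1, hb2⟩ := ihb g hg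
    obtain ⟨ha1, ha2⟩ := iha _ hb1
    simp only [map_mul, Module.End.mul_apply]
    exact ⟨ha1, by rw [ha2, hb2]⟩
  | add a b iha ihb =>
    intro g hg
    obtain ⟨hb1, hb2⟩ := ihb g hg
    obtain ⟨ha1, ha2⟩ := iha g hg
    simp only [map_add, LinearMap.add_apply]
    refine ⟨fun δ i n h => by rw [Pi.add_apply, ha1 δ i n h, hb1 δ i n h, add_zero], ?_⟩
    rw [← ha2, ← hb2]
    exact map_add laplaceLin _ _

theorem weylAction_fourierLaplace_laplace_eq_zero {g : LogSeries K d} (hg : NonIntegralSupport g)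
    {φ : WeylAlgebra K d} (h : weylAction K φ g = 0) :
    weylAction K (fourierLaplace K φ) (laplace g) = 0 := by
  rw [← (laplace_weylAction φ g hg).2, h]
  exact map_zero laplaceLin

end Weyl

/-! ### The transform of a power series times a monomial -/

section Expansion

variable {d : ℕ}

theorem prod_aeval_X_eq_sum (p : Fin d → Polynomial ℂ) (k : Fin d →₀ ℕ)
    (hp : ∀ i n, k i < n → (p i).coeff n = 0) :
    ∏ i, Polynomial.aeval (MvPolynomial.X i : MvPolynomial (Fin d) ℂ) (p i) =
      ∑ j ∈ Finset.Iic k, MvPolynomial.monomial j (∏ i, (p i).coeff (j i)) := by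
  have h1 : ∀ i, Polynomial.aeval (MvPolynomial.X i : MvPolynomial (Fin d) ℂ) (p i) =
      ∑ n ∈ Finset.Iic (k i), MvPolynomial.monomial (Finsupp.single i n) ((p i).coeff n) := by
    intro i
    have hdeg : (p i).natDegree < k i + 1 := Nat.lt_succ_iff.2
      (Polynomial.natDegree_le_iff_coeff_eq_zero.2 fun n hn => hp i n hn)
    rw [Polynomial.aeval_eq_sum_range' hdeg, Nat.range_succ_eq_Iic]
    refine Finset.sum_congr rfl fun n _ => ?_
    rw [MvPolynomial.X_pow_eq_monomial, MvPolynomial.smul_monomial, smul_eq_mul, mul_one]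
  simp only [h1]
  rw [Finset.prod_univ_sum]
  refine Finset.sum_nbij' (fun j => Finsupp.equivFunOnFinite.symm j) (fun j => ⇑j) ?_ ?_ ?_ ?_ ?_
  · intro j hj
    simp only [Fintype.mem_piFinset, Finset.mem_Iic] at hj ⊢
    exact fun i => hj i
  · intro j hj
    simp only [Fintype.mem_piFinset, Finset.mem_Iic] at hj ⊢
    exact fun i => hj i
  · intro j _
    rfl
  · intro j _
    ext
    rfl
  · intro j _
    have hsum : ∑ i, Finsupp.single i (j i) = Finsupp.equivFunOnFinite.symm j := by
      ext i
      simp [Finsupp.finsetSum_apply, Finsupp.single_apply]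
    rw [← MvPolynomial.monomial_sum_prod, hsum]
    rfl

section Field

variable {K : Type*} [Field K]

theorem map_ascJet {E : Type*} [Field E] [Algebra K E] (γ : K) (n : ℕ) :
    PowerSeries.map (algebraMap K E) (ascJet γ n) = ascJet (algebraMap K E γ) n := by
  simp [ascJet, map_prod]

theorem map_inv_linear {E : Type*} [Field E] [Algebra K E] {a : K} (ha : a ≠ 0) :
    PowerSeries.map (algebraMap K E) (PowerSeries.C a + PowerSeries.X)⁻¹ =
      (PowerSeries.C (algebraMap K E a) + PowerSeries.X)⁻¹ := by
  rw [PowerSeries.eq_inv_iff_mul_eq_one (by simpa using ha)]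
  have h := congrArg (PowerSeries.map (algebraMap K E)) (isUnit_linear ha)
  rw [map_mul, map_one, mul_comm] at h
  simpa using h

theorem map_descJet {E : Type*} [Field E] [Algebra K E] {γ : K} (hγ : ∀ n : ℤ, γ ≠ n) (n : ℕ) :
    PowerSeries.map (algebraMap K E) (descJet γ n) = descJet (algebraMap K E γ) n := by
  rw [descJet, map_mul, map_prod, descJet]
  congr 1
  · simp
  · refine Finset.prod_congr rfl fun m _ => ?_
    rw [map_inv_linear (sub_natCast_ne_zero hγ m), map_sub, map_natCast]

/-- The power series with coefficients `a_α ∏_i [T^(r_i)] u_i(α_i)`. -/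
def jetProduct (f : MvPowerSeries (Fin d) K) (u : Fin d → ℕ → PowerSeries K) (r : Fin d → ℕ) :
    MvPowerSeries (Fin d) K :=
  fun α => MvPowerSeries.coeff α f * ∏ i, PowerSeries.coeff (r i) (u i (α i))

theorem coeff_jetProduct (f : MvPowerSeries (Fin d) K) (u : Fin d → ℕ → PowerSeries K)
    (r : Fin d → ℕ) (α : Fin d →₀ ℕ) : MvPowerSeries.coeff α (jetProduct f u r) =
      MvPowerSeries.coeff α f * ∏ i, PowerSeries.coeff (r i) (u i (α i)) := rfl

variable [Algebra K ℂ]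

/-- The coefficients of `(log x)^j` in the transform of `f x^γ (log x)^k`, divided by `Γ(γ)`, when
the shifts of the Gamma function are described by the jets `u`. -/
def laplaceCoeffSeries (f : MvPowerSeries (Fin d) K) (γ : Fin d → K) (k : Fin d →₀ ℕ)
    (u : Fin d → ℕ → PowerSeries K) (j : Fin d →₀ ℕ) : MvPowerSeries (Fin d) ℂ :=
  fun α => algebraMap K ℂ (MvPowerSeries.coeff α f) *
    ∏ i, ((k i).factorial : ℂ) / (j i).factorial * (-1) ^ j i * (Complex.Gamma (algebraMap K ℂ (γ i)))⁻¹ *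
      PowerSeries.coeff (k i - j i)
        (PowerSeries.map (algebraMap K ℂ) (u i (α i)) * gammaJet (algebraMap K ℂ (γ i)))

theorem coeff_laplaceCoeffSeries (f : MvPowerSeries (Fin d) K) (γ : Fin d → K) (k : Fin d →₀ ℕ)
    (u : Fin d → ℕ → PowerSeries K) (j α : Fin d →₀ ℕ) :
    MvPowerSeries.coeff α (laplaceCoeffSeries f γ k u j) =
      algebraMap K ℂ (MvPowerSeries.coeff α f) *
      ∏ i, ((k i).factorial : ℂ) / (j i).factorial * (-1) ^ j i * (Complex.Gamma (algebraMap K ℂ (γ i)))⁻¹ *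
        PowerSeries.coeff (k i - j i)
          (PowerSeries.map (algebraMap K ℂ) (u i (α i)) * gammaJet (algebraMap K ℂ (γ i))) := rfl

theorem algebraMap_ne_intCast {x : K} (hx : ∀ n : ℤ, x ≠ n) (n : ℤ) : algebraMap K ℂ x ≠ n :=
  fun h => hx n ((algebraMap K ℂ).injective (by rw [h, map_intCast]))

/-- Expand each coefficient of a product of jets as a convolution. The Gamma side does not depend on
α, so the sum over antidiagonals is a finite complex combination of series over K. -/
theorem laplaceCoeffSeries_mem_span {s : Set (MvPowerSeries (Fin d) K)}
    (f : MvPowerSeries (Fin d) K) (γ : Fin d → K) (k : Fin d →₀ ℕ)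
    {u : Fin d → ℕ → PowerSeries K} (j : Fin d →₀ ℕ) (hs : ∀ r, jetProduct f u r ∈ s) :
    laplaceCoeffSeries f γ k u j ∈
      Submodule.span ℂ (MvPowerSeries.map (algebraMap K ℂ) '' s) := by
  have h : laplaceCoeffSeries f γ k u j =
      ∑ q ∈ Fintype.piFinset fun i => Finset.HasAntidiagonal.antidiagonal (k i - j i),
        (∏ i, ((k i).factorial : ℂ) / (j i).factorial * (-1) ^ j i *
          (Complex.Gamma (algebraMap K ℂ (γ i)))⁻¹ *
          PowerSeries.coeff (q i).2 (gammaJet (algebraMap K ℂ (γ i)))) •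
        MvPowerSeries.map (algebraMap K ℂ) (jetProduct f u fun i => (q i).1) := by
    ext α
    rw [coeff_laplaceCoeffSeries, map_sum]
    simp only [PowerSeries.coeff_mul, Finset.mul_sum, Finset.prod_univ_sum]
    refine Finset.sum_congr rfl fun q _ => ?_
    rw [MvPowerSeries.coeff_smul, MvPowerSeries.coeff_map, coeff_jetProduct, map_mul, map_prod,
      mul_left_comm, ← Finset.prod_mul_distrib]
    congr 1
    refine Finset.prod_congr rfl fun i _ => ?_
    rw [PowerSeries.coeff_map]
    ring
  rw [h]
  exact Submodule.sum_mem _ fun q _ => Submodule.smul_mem _ _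
    (Submodule.subset_span ⟨_, hs _, rfl⟩)

theorem smul_laplaceMonomial_eq_sum (f : MvPowerSeries (Fin d) K) {γ δ : Fin d → K}
    (hγ : ∀ i, ∀ n : ℤ, γ i ≠ n) (hδ : ∀ i, ∀ n : ℤ, δ i ≠ n) (k : Fin d →₀ ℕ)
    {u : Fin d → ℕ → PowerSeries K} (α : Fin d →₀ ℕ)
    (hu : ∀ i, gammaJet (algebraMap K ℂ (δ i) + 1) =
      PowerSeries.map (algebraMap K ℂ) (u i (α i)) * gammaJet (algebraMap K ℂ (γ i))) :
    algebraMap K ℂ (MvPowerSeries.coeff α f) •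
        laplaceMonomial (fun i => algebraMap K ℂ (δ i)) k =
      (∏ i, Complex.Gamma (algebraMap K ℂ (γ i))) • ∑ j ∈ Finset.Iic k,
        MvPolynomial.monomial j (MvPowerSeries.coeff α (laplaceCoeffSeries f γ k u j)) := by
  have hδ' := fun i => algebraMap_ne_intCast (hδ i)
  rw [laplaceMonomial, prod_aeval_X_eq_sum _ k fun i n hn => by
    rw [coeff_laplacePoly (hδ' i), if_neg hn.not_ge], Finset.smul_sum, Finset.smul_sum]
  refine Finset.sum_congr rfl fun j hj => ?_
  have hj' : j ≤ k := Finset.mem_Iic.1 hj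
  rw [MvPolynomial.smul_monomial, MvPolynomial.smul_monomial, coeff_laplaceCoeffSeries,
    smul_eq_mul, smul_eq_mul, mul_left_comm, ← Finset.prod_mul_distrib]
  congr 2
  refine Finset.prod_congr rfl fun i _ => ?_
  have hΓ : Complex.Gamma (algebraMap K ℂ (γ i)) ≠ 0 :=
    Complex.Gamma_ne_zero (ne_neg_natCast (algebraMap_ne_intCast (hγ i)))
  rw [coeff_laplacePoly (hδ' i), if_pos (hj' i), hu]
  field_simp

/-- In top degree only constant terms of the jets enter, and that of the Gamma expansion is Γ(γ_i),
which cancels. -/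
theorem laplaceCoeffSeries_self (f : MvPowerSeries (Fin d) K) {γ : Fin d → K}
    (hγ : ∀ i, ∀ n : ℤ, γ i ≠ n) (k : Fin d →₀ ℕ) (u : Fin d → ℕ → PowerSeries K)
    (α : Fin d →₀ ℕ) : MvPowerSeries.coeff α (laplaceCoeffSeries f γ k u k) =
      algebraMap K ℂ ((-1) ^ k.degree *
        (MvPowerSeries.coeff α f * ∏ i, PowerSeries.constantCoeff (u i (α i)))) := by
  rw [coeff_laplaceCoeffSeries, map_mul, map_mul, map_pow, map_neg, map_one, map_prod,
    mul_left_comm, Finsupp.degree_eq_sum, ← Finset.prod_pow_eq_pow_sum,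
    ← Finset.prod_mul_distrib]
  congr 1
  refine Finset.prod_congr rfl fun i _ => ?_
  have hΓ : Complex.Gamma (algebraMap K ℂ (γ i)) ≠ 0 :=
    Complex.Gamma_ne_zero (ne_neg_natCast (algebraMap_ne_intCast (hγ i)))
  have hk : ((k i).factorial : ℂ) ≠ 0 := by exact_mod_cast Nat.factorial_ne_zero _
  have hmap : PowerSeries.constantCoeff (PowerSeries.map (algebraMap K ℂ) (u i (α i))) =
      algebraMap K ℂ (PowerSeries.constantCoeff (u i (α i))) := by
    rw [← PowerSeries.coeff_zero_eq_constantCoeff_apply, PowerSeries.coeff_map,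
      PowerSeries.coeff_zero_eq_constantCoeff_apply]
  have hjet : PowerSeries.constantCoeff (gammaJet (algebraMap K ℂ (γ i))) =
      Complex.Gamma (algebraMap K ℂ (γ i)) := by
    rw [← PowerSeries.coeff_zero_eq_constantCoeff_apply, gammaJet, PowerSeries.coeff_mk]
    simp
  rw [Nat.sub_self, PowerSeries.coeff_zero_eq_constantCoeff_apply, map_mul, hmap, hjet]
  field_simp

end Field

variable {K : Type*} [Field K] [NumberField K] {v : NumberField.FinitePlace K}

theorem prod_pow_apply_eq (α : Fin d →₀ ℕ) (ρ : ℝ) : ∏ i, ρ ^ α i = ρ ^ α.degree := by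
  rw [Finset.prod_pow_eq_pow_sum, Finsupp.degree_eq_sum]

theorem polyGrowth_prod_coeff {ρ : ℝ} (hρ : 0 < ρ) {u : Fin d → ℕ → PowerSeries K}
    (hu : ∀ i, JetGrowth v ρ (u i)) (r : Fin d → ℕ) :
    PolyGrowth Finsupp.degree fun α : Fin d →₀ ℕ =>
      absV v (∏ i, PowerSeries.coeff (r i) (u i (α i))) * ρ⁻¹ ^ α.degree := by
  have h := PolyGrowth.prod (s := (Finsupp.degree : (Fin d →₀ ℕ) → ℕ)) (t := Finset.univ)
    (g := fun i α => absV v (PowerSeries.coeff (r i) (u i (α i))) * ρ⁻¹ ^ α i)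
    (fun i _ => ((hu i).upper (r i)).comp (t := fun α : Fin d →₀ ℕ => α i)
      fun α => Finsupp.le_degree i α)
    fun i α => mul_nonneg ((placeAbs v).nonneg _) (by positivity)
  refine h.mono fun α => le_of_eq ?_
  rw [Finset.prod_mul_distrib, prod_pow_apply_eq, ← placeAbs_apply, map_prod]
  rfl

theorem polyGrowth_inv_prod_constantCoeff {ρ : ℝ} (hρ : 0 < ρ) {u : Fin d → ℕ → PowerSeries K}
    (hu : ∀ i, JetGrowth v ρ (u i)) :
    PolyGrowth Finsupp.degree fun α : Fin d →₀ ℕ =>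
      (absV v (∏ i, PowerSeries.constantCoeff (u i (α i))))⁻¹ * ρ ^ α.degree := by
  have h := PolyGrowth.prod (s := (Finsupp.degree : (Fin d →₀ ℕ) → ℕ)) (t := Finset.univ)
    (g := fun i α => (absV v (PowerSeries.constantCoeff (u i (α i))))⁻¹ * ρ ^ α i)
    (fun i _ => (hu i).lower.comp (t := fun α : Fin d →₀ ℕ => α i)
      fun α => Finsupp.le_degree i α)
    fun i α => mul_nonneg (inv_nonneg.2 ((placeAbs v).nonneg _)) (by positivity)
  refine h.mono fun α => le_of_eq ?_
  rw [Finset.prod_mul_distrib, prod_pow_apply_eq, ← placeAbs_apply, map_prod,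
    Finset.prod_inv_distrib]
  rfl

theorem radius_mul_le_radius_jetProduct (hd : 0 < d) {ρ : ℝ} (hρ : 0 < ρ)
    {u : Fin d → ℕ → PowerSeries K} (hu : ∀ i, JetGrowth v ρ (u i))
    (f : MvPowerSeries (Fin d) K) (r : Fin d → ℕ) :
    radius v f * ENNReal.ofReal ρ⁻¹ ≤ radius v (jetProduct f u r) := by
  refine radius_mul_le_radius hd v hρ (polyGrowth_prod_coeff hρ hu r) fun α => le_of_eq ?_
  rw [coeff_jetProduct, ← placeAbs_apply, map_mul, placeAbs_apply, placeAbs_apply, mul_assoc,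
    ← mul_pow, inv_mul_cancel₀ hρ.ne', one_pow, mul_one]

theorem radius_eq_of_coeff_eq (hd : 0 < d) {ρ : ℝ} (hρ : 0 < ρ)
    {u : Fin d → ℕ → PowerSeries K} (hu : ∀ i, JetGrowth v ρ (u i))
    {f g : MvPowerSeries (Fin d) K} (s : K) (hs : absV v s = 1)
    (hg : ∀ α, MvPowerSeries.coeff α g =
      s * (MvPowerSeries.coeff α f * ∏ i, PowerSeries.constantCoeff (u i (α i)))) :
    radius v g = radius v f * ENNReal.ofReal ρ⁻¹ := by
  refine radius_eq_radius_mul hd v hρ (polyGrowth_prod_coeff hρ hu 0)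
    (polyGrowth_inv_prod_constantCoeff hρ hu) (fun α => le_of_eq ?_) fun α => le_of_eq ?_
  · simp only [Pi.zero_apply, PowerSeries.coeff_zero_eq_constantCoeff]
    rw [hg, ← placeAbs_apply, map_mul, map_mul, placeAbs_apply, hs, one_mul, placeAbs_apply,
      placeAbs_apply, mul_assoc, ← mul_pow, inv_mul_cancel₀ hρ.ne', one_pow, mul_one]
  · have h0 : absV v (∏ i, PowerSeries.constantCoeff (u i (α i))) ≠ 0 :=
      (placeAbs v).ne_zero (Finset.prod_ne_zero_iff.2 fun i _ => (hu i).ne_zero _)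
    have h1 : absV v (MvPowerSeries.coeff α g) = absV v (MvPowerSeries.coeff α f) *
        absV v (∏ i, PowerSeries.constantCoeff (u i (α i))) := by
      rw [hg, ← placeAbs_apply, map_mul, map_mul, placeAbs_apply, hs, one_mul]
      rfl
    rw [h1, mul_assoc, mul_assoc, ← mul_pow, mul_inv_cancel₀ hρ.ne', one_pow, mul_one,
      mul_inv_cancel₀ h0, mul_one]

variable [Algebra K ℂ]

/-- Common to both halves of the proposition: `e` lists the exponents γ + α or γ - α, and `u` the
jets that move the Gamma expansion to them. -/
theorem exists_expansion (hd : 0 < d) {ρ : ℝ} (hρ : 0 < ρ) {u : Fin d → ℕ → PowerSeries K}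
    (hu : ∀ i, JetGrowth v ρ (u i)) (f : MvPowerSeries (Fin d) K) {γ : Fin d → K}
    (hγ : ∀ i, ∀ n : ℤ, γ i ≠ n) (k : Fin d →₀ ℕ) {e : (Fin d →₀ ℕ) → Fin d → K}
    (he : Function.Injective e) (heZ : ∀ α i, ∀ n : ℤ, e α i ≠ n)
    (hjet : ∀ α i, gammaJet (algebraMap K ℂ (e α i) + 1) =
      PowerSeries.map (algebraMap K ℂ) (u i (α i)) * gammaJet (algebraMap K ℂ (γ i))) :
    ∃ F : (Fin d →₀ ℕ) → MvPowerSeries (Fin d) ℂ,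
      (∀ j ≤ k, F j ∈ Submodule.span ℂ (MvPowerSeries.map (algebraMap K ℂ) ''
        {y | radius v f * ENNReal.ofReal ρ⁻¹ ≤ radius v y})) ∧
      laplace (Function.extend e (fun α => MvPolynomial.monomial k (MvPowerSeries.coeff α f)) 0) =
        (∏ i, Complex.Gamma (algebraMap K ℂ (γ i))) • ∑ j ∈ Finset.Iic k,
          Function.extend (fun α => laplaceExponent (e α))
            (fun α => MvPolynomial.monomial j (MvPowerSeries.coeff α (F j))) 0 ∧
      (f ≠ 0 → F k ≠ 0) ∧
      ∃ g : MvPowerSeries (Fin d) K, MvPowerSeries.map (algebraMap K ℂ) g = F k ∧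
        radius v g = radius v f * ENNReal.ofReal ρ⁻¹ := by
  refine ⟨laplaceCoeffSeries f γ k u, fun j _ => laplaceCoeffSeries_mem_span f γ k j
    (radius_mul_le_radius_jetProduct hd hρ hu f), ?_, fun hf hF => ?_, ?_⟩
  · have he' : Function.Injective fun α => laplaceExponent (e α) :=
      laplaceExponent_injective.comp he
    refine logSeries_ext (e := fun α => laplaceExponent (e α)) (fun α => ?_) fun ε hε => ?_
    · rw [laplace_laplaceExponent, he.extend_apply, laplaceOp_monomial,
        smul_laplaceMonomial_eq_sum f hγ (heZ α) k α (hjet α), Pi.smul_apply, Finset.sum_apply]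
      congr 1
      exact Finset.sum_congr rfl fun j _ => (he'.extend_apply
        (fun α => MvPolynomial.monomial j (MvPowerSeries.coeff α (laplaceCoeffSeries f γ k u j))) 0
        α).symm
    · have h0 : laplace (Function.extend e
          (fun α => MvPolynomial.monomial k (MvPowerSeries.coeff α f)) 0) ε = 0 := by
        by_cases h : ∃ δ : Fin d → K, laplaceExponent δ = ε
        · obtain ⟨δ, rfl⟩ := h
          rw [laplace_laplaceExponent, Function.extend_apply', Pi.zero_apply, map_zero]
          rintro ⟨α, rfl⟩
          exact hε ⟨α, rfl⟩
        · exact laplace_eq_zero _ h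
      rw [h0, Pi.smul_apply, Finset.sum_apply, Finset.sum_eq_zero, smul_zero]
      exact fun j _ => Function.extend_apply' _ _ _ hε
  · refine hf (MvPowerSeries.ext fun α => ?_)
    have h := congrArg (MvPowerSeries.coeff α) hF
    rw [laplaceCoeffSeries_self f hγ, map_zero, map_eq_zero] at h
    have h1 : (∏ i, PowerSeries.constantCoeff (u i (α i))) ≠ 0 :=
      Finset.prod_ne_zero_iff.2 fun i _ => (hu i).ne_zero _
    rw [map_zero]
    simpa [h1] using h
  · have hg : ∀ α, MvPowerSeries.coeff α ((-1 : K) ^ k.degree • jetProduct f u 0) =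
        (-1) ^ k.degree *
          (MvPowerSeries.coeff α f * ∏ i, PowerSeries.constantCoeff (u i (α i))) := fun α => by
      simp only [MvPowerSeries.coeff_smul, coeff_jetProduct, Pi.zero_apply,
        PowerSeries.coeff_zero_eq_constantCoeff]
    refine ⟨(-1 : K) ^ k.degree • jetProduct f u 0, ?_, ?_⟩
    · ext α
      rw [laplaceCoeffSeries_self f hγ, MvPowerSeries.coeff_map, hg]
    · refine radius_eq_of_coeff_eq hd hρ hu ((-1) ^ k.degree) ?_ hg
      rw [← placeAbs_apply, map_pow, (placeAbs v).map_neg, map_one, one_pow]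

end Expansion

end LaplaceSeveral

end

/-! ### The proposition: rising jets for f, falling jets for f(1/x) -/

open LaplaceSeveral in
theorem proposition3p8 {K : Type*} [Field K] [NumberField K] [Algebra K ℂ]
    {d : ℕ} (hd : 0 < d) (v : NumberField.FinitePlace K)
    (f : MvPowerSeries (Fin d) K) (γ : Fin d → K) (k : Fin d →₀ ℕ)
    (hγp : ∀ i, γ i ∈ padicIntegers v) (hγ : ∀ i, ∀ n : ℤ, γ i ≠ n) :
    (∃ F : (Fin d →₀ ℕ) → MvPowerSeries (Fin d) ℂ,
      (∀ j ≤ k, F j ∈ complexRSet v (-1) f) ∧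
      laplace (mulH f γ k) =
        (∏ i, Complex.Gamma (algebraMap K ℂ (γ i))) •
          ∑ j ∈ Finset.Iic k, mulHInv (F j) (fun i => -algebraMap K ℂ (γ i) - 1) j ∧
      (f ≠ 0 → F k ≠ 0) ∧
      ∃ g : MvPowerSeries (Fin d) K, MvPowerSeries.map (algebraMap K ℂ) g = F k ∧
        radius v g = radius v f * ENNReal.ofReal (piV v ^ (-1 : ℝ))) ∧
    (∃ F : (Fin d →₀ ℕ) → MvPowerSeries (Fin d) ℂ,
      (∀ j ≤ k, F j ∈ complexRSet v 1 f) ∧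
      laplace (mulHInv f γ k) =
        (∏ i, Complex.Gamma (algebraMap K ℂ (γ i))) •
          ∑ j ∈ Finset.Iic k, mulH (F j) (fun i => -algebraMap K ℂ (γ i) - 1) j ∧
      (f ≠ 0 → F k ≠ 0) ∧
      ∃ g : MvPowerSeries (Fin d) K, MvPowerSeries.map (algebraMap K ℂ) g = F k ∧
        radius v g = radius v f * ENNReal.ofReal (piV v)) ∧
    (∀ φ : WeylAlgebra K d, weylAction K φ (mulH f γ k) = 0 →
      weylAction K (fourierLaplace K φ) (laplace (mulH f γ k)) = 0) ∧
    (∀ φ : WeylAlgebra K d, weylAction K φ (mulHInv f γ k) = 0 →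
      weylAction K (fourierLaplace K φ) (laplace (mulHInv f γ k)) = 0) := by
  have hγ' := fun i => algebraMap_ne_intCast (hγ i)
  refine ⟨?_, ?_, fun φ => weylAction_fourierLaplace_laplace_eq_zero
    (nonIntegralSupport_mulH hγ f k), fun φ => weylAction_fourierLaplace_laplace_eq_zero
    (nonIntegralSupport_mulHInv hγ f k)⟩
  · have h := exists_expansion hd (piV_pos v) (fun i => jetGrowth_ascJet (hγp i) (hγ i)) f hγ k
      (e := fun α i => γ i + (α i : K)) (fun α β h => by
        ext i
        simpa using congrFun h i)
      (fun α i => by simpa using add_intCast_ne (hγ i) (α i)) fun α i => by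
        rw [map_ascJet, ← gammaJet_add_natCast (hγ' i), map_add, map_natCast]
    -- Since δ becomes -δ-1, the exponents γ + α turn into those of a series in 1/x times x^(-γ-1).
    have he : (fun (α : Fin d →₀ ℕ) => laplaceExponent fun i => γ i + (α i : K)) =
        fun α i => (-algebraMap K ℂ (γ i) - 1) - (α i : ℂ) := by
      funext α i
      simp only [laplaceExponent, map_add, map_natCast]
      ring
    rw [he] at h
    simp only [complexRSet, RSet, Rat.cast_neg, Rat.cast_one, Real.rpow_neg_one]
    exact h
  -- The falling jets grow like π_v^(-n), so ρ = π_v⁻¹ and the radius is multiplied by π_v.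
  · have h := exists_expansion hd (inv_pos.2 (piV_pos v))
      (fun i => jetGrowth_descJet (hγp i) (hγ i)) f hγ k
      (e := fun α i => γ i - (α i : K)) (fun α β h => by
        ext i
        simpa using congrFun h i)
      (fun α i => by simpa [sub_eq_add_neg] using add_intCast_ne (hγ i) (-α i)) fun α i => by
        rw [map_descJet (hγ i), ← gammaJet_sub_natCast (hγ' i), map_sub, map_natCast]
    have he : (fun (α : Fin d →₀ ℕ) => laplaceExponent fun i => γ i - (α i : K)) =
        fun α i => (-algebraMap K ℂ (γ i) - 1) + (α i : ℂ) := by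
      funext α i
      simp only [laplaceExponent, map_sub, map_natCast]
      ring
    rw [he, inv_inv] at h
    simp only [complexRSet, RSet, Rat.cast_one, Real.rpow_one]
    exact h
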